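/- **Lemma (Time estimate).** Let $n\ge 1$ be an integer, $-\tfrac12\le s\le 2n-\tfrac12$ and $b_0>0$. There is a constant $$c_2=c_2\big(T,\|b\|_{C^{n-1}([0,T])},\|c\|_{C^{n-1}([0,T])},n,b_0,s\big)>0 ,$$ which remains uniformly bounded as $T\to0^+$ (as long as the two coefficient norms stay bounded), such that the following holds. Let $L,T>0$, let $b,c\in C^n([0,T])$ be real-valued with $b(t)\ge b_0$ on $[0,T]$, let $u_0\in H^s(0,L)$, and let $U_0\in H^s(\mathbb R)$ satisfy $U_0|_{(0,L)}=u_0$ and $\|U_0\|_{H^s(\mathbb R)}\le 2\|u_0\|_{H^s(0,L)}$. Let $U\in C([0,T];H^s(\mathbb R))$ be the (weak) solution of the Cauchy problem $$U_t=b(t)U_{xx}+c(t)U_x\quad (x\in\mathbb R,\ 0<t<T),\qquad U(\cdot,0)=U_0 .$$ Then for each $t\in(0,T)$ the distribution $U(\cdot,t)$ is a continuous function of $x$, for each $x\in[0,L]$ the function $U(x,\cdot)$ is locally integrable on $(0,T)$, and $$\sup_{x\in[0,L]}\|U(x,\cdot)\|_{H^{\frac{2s+1}{4}}(0,T)}\le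 c_2\,\|u_0\|_{H^s(0,L)} .$$ Here functions and distributions are complex-valued, $\|F\|_{H^\sigma(\mathbb R)}^2=\int_{\mathbb R}(1+k^2)^\sigma|\hat F(k)|^2\,dk$ with $\hat F(k)=\int_{\mathbb R} e^{-ikx}F(x)\,dx$ (for tempered distributions $F$), and for an open interval $I$ the space $H^\sigma(I)$ consists of the restrictions to $I$ of elements of $H^\sigma(\mathbb R)$, normed by $\|f\|_{H^\sigma(I)}=\inf\{\|F\|_{H^\sigma(\mathbb R)}: F|_I=f\}$. Weak solution means that, for every Schwartz function $\varphi$, $\tfrac{d}{dt}\langle U(t),\varphi\rangle=\langle b(t)U_{xx}(t)+c(t)U_x(t),\varphi\rangle$ for $0<t<T$. -/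

import Mathlib

open MeasureTheory TemperedDistribution Set Filter Topology
open scoped ENNReal SchwartzMap Distributions FourierTransform CompactConvergenceCLM

noncomputable section

namespace HeatTrace

/-- The weight `(1 + k ^ 2) ^ (s / 2)` at the angular frequency `k = 2 π ξ`. -/
def weight (s : ℝ) (ξ : ℝ) : ℂ := (((1 + (2 * Real.pi * ξ) ^ 2) ^ (s / 2) : ℝ) : ℂ)

/-- The norm of `H^s(ℝ)`, with value `∞` outside of `H^s(ℝ)`. With `F̂(k) = ∫ e^{-ikx} F(x) dx`,
i.e. `F̂(2πξ) = (𝓕 F)(ξ)`, it is `(∫ (1 + k²)^s |F̂(k)|² dk)^{1/2}`; the factor `√(2π)` comes from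
the substitution `k = 2πξ`. There is at most one `g` over which the infimum is taken. -/
def sobolevENorm (s : ℝ) (F : 𝓢'(ℝ, ℂ)) : ℝ≥0∞ :=
  ⨅ (g : Lp ℂ 2 (volume : Measure ℝ))
    (_ : smulLeftCLM ℂ (weight s) (𝓕 F) = (g : 𝓢'(ℝ, ℂ))),
    ENNReal.ofReal (Real.sqrt (2 * Real.pi)) * ‖g‖ₑ

/-- The open interval `(a, b)` as an open set. -/
def openIoo (a b : ℝ) : TopologicalSpace.Opens ℝ := ⟨Ioo a b, isOpen_Ioo⟩

/-- A test function on `Ω`, extended by zero, as a Schwartz function on the line. -/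
def testToSchwartz {Ω : TopologicalSpace.Opens ℝ} (φ : 𝓓(Ω, ℝ)) : 𝓢(ℝ, ℂ) :=
  HasCompactSupport.toSchwartzMap (f := fun x => ((φ x : ℝ) : ℂ))
    (φ.hasCompactSupport.comp_left (g := fun y : ℝ => (y : ℂ)) Complex.ofReal_zero)
    (Complex.ofRealCLM.contDiff.comp φ.contDiff)

/-- `F|_Ω = u` in the sense of distributions on `Ω`. -/
def RestrictsTo {Ω : TopologicalSpace.Opens ℝ} (F : 𝓢'(ℝ, ℂ)) (u : 𝓓'(Ω, ℂ)) : Prop :=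
  ∀ φ : 𝓓(Ω, ℝ), F (testToSchwartz φ) = u φ

/-- The norm of the Sobolev space `H^s(Ω)` of restrictions to `Ω` of elements of `H^s(ℝ)`: the
infimum of the `H^s(ℝ)` norms of all extensions, with value `∞` outside of `H^s(Ω)`. -/
def sobolevENormOn {Ω : TopologicalSpace.Opens ℝ} (s : ℝ) (u : 𝓓'(Ω, ℂ)) : ℝ≥0∞ :=
  ⨅ (F : 𝓢'(ℝ, ℂ)) (_ : RestrictsTo F u), sobolevENorm s F

/-- The distribution `φ ↦ ∫ φ(x) f(x) dx` on `Ω` given by a locally integrable function `f`. -/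
def funDistribution (Ω : TopologicalSpace.Opens ℝ) (f : ℝ → ℂ) : 𝓓'(Ω, ℂ) :=
  TestFunction.integralAgainstBilinCLM (ContinuousLinearMap.lsmul ℝ ℝ) volume f

/-- The norm of `C^m([0, T])`: the sum of the suprema over `[0, T]` of the absolute values of the
derivatives of order `0, …, m` (one-sided at the end points). -/
def contDiffNorm (m : ℕ) (T : ℝ) (f : ℝ → ℝ) : ℝ :=
  ∑ j ∈ Finset.range (m + 1), ⨆ t : Icc (0 : ℝ) T, |iteratedDerivWithin j f (Icc 0 T) t|

/-- `U ∈ C([0, T]; H^s(ℝ))` is a (weak) solution of the Cauchy problem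
`U_t = b(t) U_xx + c(t) U_x` for `0 < t < T`, `U(0) = U₀`, on the whole line. -/
structure IsCauchySolution (b c : ℝ → ℝ) (T s : ℝ) (U₀ : 𝓢'(ℝ, ℂ)) (U : ℝ → 𝓢'(ℝ, ℂ)) :
    Prop where
  initial : U 0 = U₀
  memSobolev : ∀ t ∈ Icc 0 T, MemSobolev s 2 (U t)
  continuous : ∀ t ∈ Icc 0 T,
    Tendsto (fun r => sobolevENorm s (U r - U t)) (𝓝[Icc 0 T] t) (𝓝 0)
  equation : ∀ t ∈ Ioo 0 T, ∀ φ : 𝓢(ℝ, ℂ),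
    HasDerivAt (fun r => U r φ)
      (((b t : ℂ) • derivCLM ℂ (derivCLM ℂ (U t)) + (c t : ℂ) • derivCLM ℂ (U t)) φ) t

/-- `u(x, t)` are the point values of `U`: for every `t` in `(0, T)`, the function `u(·, t)` is the
(unique) continuous function that represents the distribution `U t`. -/
def IsPointValues (T : ℝ) (U : ℝ → 𝓢'(ℝ, ℂ)) (u : ℝ → ℝ → ℂ) : Prop :=
  ∀ t ∈ Ioo 0 T, Continuous (fun x => u x t) ∧
    ∀ φ : 𝓢(ℝ, ℂ), Integrable (fun x => φ x * u x t) ∧ U t φ = ∫ x, φ x * u x t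

end HeatTrace

end

/-!
The heat equation with coefficients depending only on time is diagonal on the Fourier side. With
`k = 2πξ` and the primitives `B`, `C` of `b`, `c`, the solution has the Fourier transform
`exp (-k² B(t) + i k C(t)) v₀(ξ)`, where `v₀` is the Fourier transform of the initial datum
(`IsCauchySolution.hasDensity`). A weak solution has this form because the pairing of its Fourier
transform with test functions damped by `exp (k² B(t) - i k C(t))` is constant in time.

Hence, for fixed `x`, the trace `t ↦ U(x, t)` is a superposition `∫ g(ξ) m(ξ, t) dξ` with
`|g| = |v₀|` and the multiplier `m(ξ, t) = exp (-k² B(t) + i k C(t))`. Put `κ = 1 + k²`. Since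
`b ≥ b₀`, the `j`-th time derivative of `m`, `j ≤ n`, is bounded on `[0, T]` by a constant times
`κ^j e^{-b₀ κ t}`, and the constant involves the coefficients only up to the order `n - 1`. For
each `ξ` the multiplier is continued from `[0, T]` to the line by prescribing its jets of order
`n - 1` at the end points on the time scale `κ⁻¹` (`glue`). This choice of the scale keeps the bounds
`κ^j e^{-b₀ κ |t|}` with a constant that does not blow up for short intervals (`exists_kernel`).

A Schur test for the Laplace kernel `e^{-a κ |t|}` (`lintegral_sq_laplace_le`) shows that
superpositions with a kernel of size `κ^p e^{-a κ |t|}` are in `L²` in time if `g` is in `L²` with the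
weight `κ^{2p - 1/2}`. Applied to `m` and to its `n`-th derivative this gives the `L²` and the `H^n`
bounds; real interpolation by truncation of `g` in frequency (`lintegral_interpolate`) gives `H^σ`
with the weight `κ^{2σ - 1/2}` for all `0 ≤ σ ≤ n` (`lintegral_fourier_superpose_le`). For
`σ = (2s + 1) / 4` the weight is `κ^s`, which is the one of `H^s(ℝ)`.
-/

noncomputable section

namespace HeatTrace

/-! ### A Schur test for the Laplace kernel -/

/-- The weight `1 + k ^ 2` at the angular frequency `k = 2 π ξ`. -/
def kap (ξ : ℝ) : ℝ := 1 + (2 * Real.pi * ξ) ^ 2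

lemma one_le_kap (ξ : ℝ) : 1 ≤ kap ξ := by unfold kap; nlinarith [sq_nonneg (2 * Real.pi * ξ)]

lemma kap_pos (ξ : ℝ) : 0 < kap ξ := lt_of_lt_of_le one_pos (one_le_kap ξ)

lemma continuous_kap : Continuous kap := by unfold kap; fun_prop

@[fun_prop]
lemma measurable_kap : Measurable kap := continuous_kap.measurable

lemma lintegral_ofReal_eq {α : Type*} [MeasurableSpace α] {μ : Measure α} {f : α → ℝ}
    (hf : Integrable f μ) (h0 : 0 ≤ f) :
    ∫⁻ x, ENNReal.ofReal (f x) ∂μ = ENNReal.ofReal (∫ x, f x ∂μ) :=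
  (ofReal_integral_eq_lintegral_ofReal hf (ae_of_all _ h0)).symm

/-- The Cauchy-Schwarz inequality for `ℝ≥0∞`-valued functions, in squared form. -/
lemma sq_lintegral_mul_le {α : Type*} [MeasurableSpace α] {μ : Measure α} {f g : α → ℝ≥0∞}
    (hf : AEMeasurable f μ) (hg : AEMeasurable g μ) :
    (∫⁻ x, f x * g x ∂μ) ^ 2 ≤ (∫⁻ x, f x ^ 2 ∂μ) * ∫⁻ x, g x ^ 2 ∂μ := by
  have h := ENNReal.lintegral_mul_le_Lp_mul_Lq μ Real.HolderConjugate.two_two hf hg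
  have h2 : ∀ y : ℝ≥0∞, (y ^ (1 / (2 : ℝ))) ^ 2 = y := fun y => by
    rw [← ENNReal.rpow_natCast, ← ENNReal.rpow_mul]; norm_num
  simp only [Pi.mul_apply, ENNReal.rpow_two] at h
  calc _ ≤ _ := pow_le_pow_left' h 2
    _ = _ := by rw [mul_pow, h2, h2]

lemma lintegral_exp_kap_le {a t : ℝ} (ha : 0 < a) (ht : 0 < t) :
    ∫⁻ ξ, ENNReal.ofReal (Real.exp (-(a * kap ξ * t))) ≤
      ENNReal.ofReal (√Real.pi / (2 * Real.pi * √a) * t ^ (-(1 / 2) : ℝ)) := by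
  have hb : 0 < a * t * (2 * Real.pi) ^ 2 := by positivity
  have h1 : ∀ ξ, Real.exp (-(a * kap ξ * t)) ≤ Real.exp (-(a * t * (2 * Real.pi) ^ 2) * ξ ^ 2) := by
    intro ξ
    apply Real.exp_le_exp.2
    unfold kap
    nlinarith [mul_pos ha ht]
  calc _ ≤ ∫⁻ ξ, ENNReal.ofReal (Real.exp (-(a * t * (2 * Real.pi) ^ 2) * ξ ^ 2)) :=
        lintegral_mono fun ξ => ENNReal.ofReal_le_ofReal (h1 ξ)
    _ = ENNReal.ofReal (√(Real.pi / (a * t * (2 * Real.pi) ^ 2))) := by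
        rw [lintegral_ofReal_eq (integrable_exp_neg_mul_sq hb) (fun _ => (Real.exp_pos _).le),
          integral_gaussian]
    _ = _ := by
        congr 1
        rw [Real.sqrt_div Real.pi_pos.le, Real.sqrt_mul (by positivity), Real.sqrt_mul ha.le,
          Real.sqrt_sq (by positivity), Real.rpow_neg ht.le, ← Real.sqrt_eq_rpow]
        have : 0 < √t := Real.sqrt_pos.2 ht
        have : 0 < √a := Real.sqrt_pos.2 ha
        field_simp

lemma lintegral_rpow_mul_exp_le {r : ℝ} (hr : 0 < r) :
    ∫⁻ t : ℝ, ENNReal.ofReal (|t| ^ (-(1 / 2) : ℝ) * Real.exp (-(r * |t|))) ≤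
      ENNReal.ofReal (2 * √Real.pi / √r) := by
  have hg := Real.integral_rpow_mul_exp_neg_mul_Ioi (a := 1 / 2) (by norm_num) hr
  rw [Real.Gamma_one_half_eq, show (1 / 2 - 1 : ℝ) = -(1 / 2) by norm_num] at hg
  have hi : IntegrableOn (fun t : ℝ => t ^ (-(1 / 2) : ℝ) * Real.exp (-(r * t))) (Ioi 0) := by
    apply MeasureTheory.Integrable.of_integral_ne_zero
    rw [hg]
    positivity
  have hi2 : IntegrableOn (fun t : ℝ => |t| ^ (-(1 / 2) : ℝ) * Real.exp (-(r * |t|))) (Ioi 0) :=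
    hi.congr_fun (fun t ht => by simp only [abs_of_pos (show (0:ℝ) < t from ht)]) measurableSet_Ioi
  have hc := integral_comp_abs (f := fun t : ℝ => t ^ (-(1 / 2) : ℝ) * Real.exp (-(r * t)))
  have hI : Integrable (fun t : ℝ => |t| ^ (-(1 / 2) : ℝ) * Real.exp (-(r * |t|))) := by
    apply MeasureTheory.Integrable.of_integral_ne_zero
    rw [hc, hg]
    positivity
  rw [lintegral_ofReal_eq hI (fun t => by positivity), hc]
  apply ENNReal.ofReal_le_ofReal
  rw [hg, ← Real.sqrt_eq_rpow, Real.sqrt_div zero_le_one, Real.sqrt_one]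
  apply le_of_eq
  field_simp

/-- A Schur type bound for the Laplace kernel: `∫ e^{-a κ |t|} dξ` is of order `|t|^{-1/2}`, while
`∫ |t|^{-1/2} e^{-a κ |t|} dt` is of order `κ^{-1/2}`. -/
lemma lintegral_sq_laplace_le {a : ℝ} (ha : 0 < a) (p : ℝ) {G : ℝ → ℝ≥0∞} (hG : AEMeasurable G) :
    ∫⁻ t : ℝ, (∫⁻ ξ, G ξ * ENNReal.ofReal (kap ξ ^ p * Real.exp (-(a * kap ξ * |t|)))) ^ 2 ≤
      ENNReal.ofReal (1 / a) * ∫⁻ ξ, G ξ ^ 2 * ENNReal.ofReal (kap ξ ^ (2 * p - 1 / 2)) := by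
  have key : ∀ t : ℝ, t ≠ 0 →
      (∫⁻ ξ, G ξ * ENNReal.ofReal (kap ξ ^ p * Real.exp (-(a * kap ξ * |t|)))) ^ 2 ≤
      ∫⁻ ξ, G ξ ^ 2 * ENNReal.ofReal (kap ξ ^ (2 * p)) *
        (ENNReal.ofReal (√Real.pi / (2 * Real.pi * √a)) *
        ENNReal.ofReal (|t| ^ (-(1 / 2) : ℝ) * Real.exp (-(a * kap ξ * |t|)))) := by
    intro t ht
    have ht' : 0 < |t| := abs_pos.2 ht
    have e1 : ∀ ξ, G ξ * ENNReal.ofReal (kap ξ ^ p * Real.exp (-(a * kap ξ * |t|))) =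
        (G ξ * ENNReal.ofReal (kap ξ ^ p * Real.exp (-(a * kap ξ * |t|) / 2))) *
          ENNReal.ofReal (Real.exp (-(a * kap ξ * |t|) / 2)) := by
      intro ξ
      have := kap_pos ξ
      rw [mul_assoc (G ξ), ← ENNReal.ofReal_mul (by positivity), mul_assoc (kap ξ ^ p),
        ← Real.exp_add]
      congr 4; ring
    have e2 : ∀ ξ, ENNReal.ofReal (Real.exp (-(a * kap ξ * |t|) / 2)) ^ 2 =
        ENNReal.ofReal (Real.exp (-(a * kap ξ * |t|))) := by
      intro ξ
      rw [← ENNReal.ofReal_pow (Real.exp_pos _).le, ← Real.exp_nat_mul]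
      congr 2; push_cast; ring
    have e3 : ∀ ξ, (G ξ * ENNReal.ofReal (kap ξ ^ p * Real.exp (-(a * kap ξ * |t|) / 2))) ^ 2 =
        G ξ ^ 2 * ENNReal.ofReal (kap ξ ^ (2 * p)) *
          ENNReal.ofReal (Real.exp (-(a * kap ξ * |t|))) := by
      intro ξ
      have := kap_pos ξ
      rw [ENNReal.ofReal_mul (by positivity), mul_pow, mul_pow, e2, mul_comm 2 p,
        Real.rpow_mul this.le, ← ENNReal.ofReal_pow (by positivity)]
      norm_num [mul_assoc]
    simp_rw [e1]
    refine (sq_lintegral_mul_le ?_ ?_).trans ?_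
    · fun_prop
    · fun_prop
    simp_rw [e2, e3]
    refine (mul_le_mul_right (lintegral_exp_kap_le ha ht') _).trans ?_
    rw [← lintegral_mul_const'' _ (by fun_prop)]
    apply le_of_eq
    congr 1
    ext ξ
    rw [ENNReal.ofReal_mul (by positivity), ENNReal.ofReal_mul (by positivity)]
    ring
  have hae : ∀ᵐ t : ℝ, t ≠ 0 := by simp [ae_iff]
  refine (lintegral_mono_ae (hae.mono fun t ht => key t ht)).trans ?_
  rw [lintegral_lintegral_swap]
  · rw [← lintegral_const_mul'' _ (by fun_prop)]
    apply lintegral_mono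
    intro ξ
    have hk := kap_pos ξ
    have : 0 < √a := Real.sqrt_pos.2 ha
    dsimp only
    rw [lintegral_const_mul _ (by fun_prop), lintegral_const_mul _ (by fun_prop)]
    refine (mul_le_mul_right (mul_le_mul_right
      (lintegral_rpow_mul_exp_le (mul_pos ha hk)) _) _).trans ?_
    rw [← ENNReal.ofReal_mul (by positivity), mul_left_comm, mul_assoc,
      ← ENNReal.ofReal_mul (by positivity), ← ENNReal.ofReal_mul (by positivity)]
    apply le_of_eq
    congr 2
    rw [Real.rpow_sub hk, ← Real.sqrt_eq_rpow, Real.sqrt_mul ha.le]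
    have : 0 < √(kap ξ) := Real.sqrt_pos.2 hk
    have h1 := Real.mul_self_sqrt ha.le
    have h2 := Real.mul_self_sqrt Real.pi_pos.le
    field_simp
    rw [Real.sq_sqrt ha.le, Real.sq_sqrt Real.pi_pos.le]
  · fun_prop

/-! ### Interpolation of weighted `L²` bounds -/

lemma lintegral_Ioc_rpow {v r : ℝ} (hv : 0 < v) (hr : 0 < r) :
    ∫⁻ R in Ioc 0 v, ENNReal.ofReal (r * R ^ (r - 1)) = ENNReal.ofReal (v ^ r) := by
  have hi : IntervalIntegrable (fun R : ℝ => r * R ^ (r - 1)) volume 0 v :=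
    (intervalIntegral.intervalIntegrable_rpow' (by linarith)).const_mul r
  rw [← ofReal_integral_eq_lintegral_ofReal
      ((intervalIntegrable_iff_integrableOn_Ioc_of_le hv.le).1 hi)
      ((ae_restrict_iff' measurableSet_Ioc).2 (ae_of_all _ fun R hR => by
        have := hR.1; simp only [Pi.zero_apply]; positivity)),
    ← intervalIntegral.integral_of_le hv.le, intervalIntegral.integral_const_mul,
    integral_rpow (Or.inl (by linarith))]
  simp [Real.zero_rpow hr.ne']
  congr 1
  field_simp

lemma lintegral_Ici_rpow {w r q : ℝ} (hw : 0 < w) (hr : 0 < r) (hq : 0 < q) :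
    ∫⁻ R in Ici w, ENNReal.ofReal (r * R ^ (-q - 1)) = ENNReal.ofReal (r / q * w ^ (-q)) := by
  rw [setLIntegral_congr Ioi_ae_eq_Ici.symm, ← ofReal_integral_eq_lintegral_ofReal
      ((integrableOn_Ioi_rpow_of_lt (by linarith) hw).const_mul r)
      ((ae_restrict_iff' measurableSet_Ioi).2 (ae_of_all _ fun R hR => by
        have : 0 < R := hw.trans hR
        simp only [Pi.zero_apply]; positivity)), integral_const_mul,
    integral_Ioi_rpow_of_lt (by linarith) hw]
  congr 1
  simp
  field_simp

/-- Real interpolation by truncation: if for every level `R` the part of `φ` above the level is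
controlled by the part of `f` above it and by a weighted part of `f` below it, then integrating
against `2 σ R ^ (2 σ - 1) dR` gives the bound with the intermediate weight. -/
lemma lintegral_interpolate {w v : ℝ → ℝ} (hw : Measurable w) (hv : Measurable v)
    (hw0 : ∀ x, 0 < w x) (hv0 : ∀ x, 0 < v x) {f φ : ℝ → ℝ≥0∞} (hf : AEMeasurable f)
    (hφ : AEMeasurable φ) {K : ℝ≥0∞} {N σ : ℝ} (hσ : 0 < σ) (hσN : σ < N)
    (h : ∀ R, 0 < R → ∫⁻ y, {y | R ≤ v y}.indicator φ y ≤
      K * ((∫⁻ x, {x | R < w x}.indicator f x) + ENNReal.ofReal (R ^ (-(2 * N))) *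
        ∫⁻ x, {x | w x ≤ R}.indicator (fun x => f x * ENNReal.ofReal (w x ^ (2 * N))) x)) :
    ∫⁻ y, φ y * ENNReal.ofReal (v y ^ (2 * σ)) ≤
      K * (ENNReal.ofReal (1 + σ / (N - σ)) * ∫⁻ x, f x * ENNReal.ofReal (w x ^ (2 * σ))) := by
  have h2 : 0 < 2 * σ := by linarith
  have mS : MeasurableSet {p : ℝ × ℝ | p.2 ≤ v p.1} :=
    measurableSet_le measurable_snd (hv.comp measurable_fst)
  have mT : MeasurableSet {p : ℝ × ℝ | p.2 < w p.1} :=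
    measurableSet_lt measurable_snd (hw.comp measurable_fst)
  have mT' : MeasurableSet {p : ℝ × ℝ | w p.1 ≤ p.2} :=
    measurableSet_le (hw.comp measurable_fst) measurable_snd
  have e1 : ∀ y, φ y * ENNReal.ofReal (v y ^ (2 * σ)) = ∫⁻ R in Ioi (0 : ℝ),
      {p : ℝ × ℝ | p.2 ≤ v p.1}.indicator
        (fun p => φ p.1 * ENNReal.ofReal (2 * σ * p.2 ^ (2 * σ - 1))) (y, R) := by
    intro y
    rw [← lintegral_Ioc_rpow (hv0 y) h2, ← lintegral_const_mul _ (by fun_prop),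
      ← lintegral_indicator measurableSet_Ioc, ← lintegral_indicator measurableSet_Ioi]
    congr 1; ext R
    by_cases h0 : 0 < R <;> by_cases h1 : R ≤ v y <;> simp [indicator, h0, h1]
  have e2 : ∀ x, (∫⁻ R in Ioi (0 : ℝ), {p : ℝ × ℝ | p.2 < w p.1}.indicator
        (fun p => f p.1 * ENNReal.ofReal (2 * σ * p.2 ^ (2 * σ - 1))) (x, R)) =
        f x * ENNReal.ofReal (w x ^ (2 * σ)) := by
    intro x
    rw [← lintegral_Ioc_rpow (hw0 x) h2, ← setLIntegral_congr Ioo_ae_eq_Ioc,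
      ← lintegral_const_mul _ (by fun_prop),
      ← lintegral_indicator measurableSet_Ioo, ← lintegral_indicator measurableSet_Ioi]
    congr 1; ext R
    by_cases h0 : 0 < R <;> by_cases h1 : R < w x <;> simp [indicator, h0, h1]
  have e3 : ∀ x, (∫⁻ R in Ioi (0 : ℝ), {p : ℝ × ℝ | w p.1 ≤ p.2}.indicator
        (fun p => f p.1 * ENNReal.ofReal (w p.1 ^ (2 * N)) *
          ENNReal.ofReal (2 * σ * p.2 ^ (-(2 * (N - σ)) - 1))) (x, R)) =
        ENNReal.ofReal (σ / (N - σ)) * (f x * ENNReal.ofReal (w x ^ (2 * σ))) := by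
    intro x
    have hx := hw0 x
    have hN : 0 < N - σ := by linarith
    calc _ = f x * ENNReal.ofReal (w x ^ (2 * N)) *
          ∫⁻ R in Ici (w x), ENNReal.ofReal (2 * σ * R ^ (-(2 * (N - σ)) - 1)) := by
          rw [← lintegral_const_mul _ (by fun_prop), ← lintegral_indicator measurableSet_Ici,
            ← lintegral_indicator measurableSet_Ioi]
          congr 1; ext R
          by_cases h1 : w x ≤ R
          · have h0 : 0 < R := hx.trans_le h1
            simp [indicator, h0, h1]
          · simp [indicator, h1]
      _ = _ := by
          rw [lintegral_Ici_rpow hx h2 (by linarith), mul_assoc,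
            ← ENNReal.ofReal_mul (by positivity), mul_left_comm (ENNReal.ofReal _) (f x),
            ← ENNReal.ofReal_mul (by positivity)]
          congr 2
          rw [mul_left_comm, ← Real.rpow_add hx]
          have : (2 * N + -(2 * (N - σ))) = 2 * σ := by ring
          rw [this]
          field_simp
  simp_rw [e1]
  rw [lintegral_lintegral_swap]
  · calc _ ≤ ∫⁻ R in Ioi (0 : ℝ), K * ((∫⁻ x, {p : ℝ × ℝ | p.2 < w p.1}.indicator
        (fun p => f p.1 * ENNReal.ofReal (2 * σ * p.2 ^ (2 * σ - 1))) (x, R)) +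
          ∫⁻ x, {p : ℝ × ℝ | w p.1 ≤ p.2}.indicator
        (fun p => f p.1 * ENNReal.ofReal (w p.1 ^ (2 * N)) *
          ENNReal.ofReal (2 * σ * p.2 ^ (-(2 * (N - σ)) - 1))) (x, R)) := by
          apply setLIntegral_mono' measurableSet_Ioi
          intro R hR
          have hR : 0 < R := hR
          have i1 : ∀ y, {p : ℝ × ℝ | p.2 ≤ v p.1}.indicator
              (fun p => φ p.1 * ENNReal.ofReal (2 * σ * p.2 ^ (2 * σ - 1))) (y, R) =
              {y | R ≤ v y}.indicator φ y * ENNReal.ofReal (2 * σ * R ^ (2 * σ - 1)) := by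
            intro y; by_cases h1 : R ≤ v y <;> simp [indicator, h1]
          have i2 : ∀ y, {p : ℝ × ℝ | p.2 < w p.1}.indicator
              (fun p => f p.1 * ENNReal.ofReal (2 * σ * p.2 ^ (2 * σ - 1))) (y, R) =
              {y | R < w y}.indicator f y * ENNReal.ofReal (2 * σ * R ^ (2 * σ - 1)) := by
            intro y; by_cases h1 : R < w y <;> simp [indicator, h1]
          have i3 : ∀ x, {p : ℝ × ℝ | w p.1 ≤ p.2}.indicator
              (fun p => f p.1 * ENNReal.ofReal (w p.1 ^ (2 * N)) *
              ENNReal.ofReal (2 * σ * p.2 ^ (-(2 * (N - σ)) - 1))) (x, R) =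
              {x | w x ≤ R}.indicator (fun x => f x * ENNReal.ofReal (w x ^ (2 * N))) x *
              (ENNReal.ofReal (R ^ (-(2 * N))) * ENNReal.ofReal (2 * σ * R ^ (2 * σ - 1))) := by
            intro x
            rw [← ENNReal.ofReal_mul (by positivity), mul_left_comm, ← Real.rpow_add hR]
            have : -(2 * N) + (2 * σ - 1) = -(2 * (N - σ)) - 1 := by ring
            rw [this]
            by_cases h1 : w x ≤ R <;> simp [indicator, h1]
          simp_rw [i1, i2, i3]
          rw [lintegral_mul_const' _ _ ENNReal.ofReal_ne_top,
            lintegral_mul_const' _ _ ENNReal.ofReal_ne_top,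
            lintegral_mul_const' _ _ (ENNReal.mul_ne_top ENNReal.ofReal_ne_top
              ENNReal.ofReal_ne_top)]
          refine (mul_le_mul_left (h R hR) _).trans (le_of_eq ?_)
          ring
      _ = _ := by
          have m1 : AEMeasurable ({p : ℝ × ℝ | p.2 < w p.1}.indicator
              (fun p => f p.1 * ENNReal.ofReal (2 * σ * p.2 ^ (2 * σ - 1))))
              (volume.prod (volume.restrict (Ioi 0))) :=
            (hf.comp_fst.mul (by fun_prop)).indicator mT
          have m2 : AEMeasurable ({p : ℝ × ℝ | w p.1 ≤ p.2}.indicator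
              (fun p => f p.1 * ENNReal.ofReal (w p.1 ^ (2 * N)) *
              ENNReal.ofReal (2 * σ * p.2 ^ (-(2 * (N - σ)) - 1))))
              (volume.prod (volume.restrict (Ioi 0))) :=
            ((hf.comp_fst.mul (by fun_prop)).mul (by fun_prop)).indicator mT'
          have l1 := m1.prod_swap.lintegral_prod_right'
          have l2 := m2.prod_swap.lintegral_prod_right'
          rw [lintegral_const_mul'' _ (by exact l1.add l2), lintegral_add_left' (by exact l1)]
          refine (congrArg (K * ·) (congrArg₂ (· + ·)
            (lintegral_lintegral_swap (by exact m1.prod_swap))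
            (lintegral_lintegral_swap (by exact m2.prod_swap)))).trans ?_
          simp_rw [e2, e3]
          rw [lintegral_const_mul'' _ (by fun_prop),
            ENNReal.ofReal_add zero_le_one (div_nonneg hσ.le (by linarith)),
            ENNReal.ofReal_one, add_mul, one_mul]
  · exact (hφ.comp_fst.mul (by fun_prop)).indicator mS

/-! ### The Fourier transform on `L¹ ∩ L²` -/

lemma continuous_fourier_of_integrable {f : ℝ → ℂ} (hf : Integrable f) : Continuous (𝓕 f) :=
  VectorFourier.fourierIntegral_continuous Real.continuous_fourierChar
    (innerSL ℝ).continuous₂ hf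

lemma norm_fourier_le_integral_norm (f : ℝ → ℂ) (τ : ℝ) : ‖𝓕 f τ‖ ≤ ∫ t, ‖f t‖ := by
  rw [Real.fourier_eq]
  refine (norm_integral_le_integral_norm _).trans (le_of_eq ?_)
  simp_rw [Circle.norm_smul]

/-- On `L¹ ∩ L²` the Fourier transform of `L²` is given by the Fourier integral. -/
lemma fourier_toLp_ae_eq {f : ℝ → ℂ} (hf : Integrable f) (hf2 : MemLp f 2) :
    (𝓕 (hf2.toLp f) : Lp ℂ 2 (volume : Measure ℝ)) =ᵐ[volume] 𝓕 f := by
  apply ae_eq_of_integral_contDiff_smul_eq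
  · exact (Lp.memLp _).locallyIntegrable (by norm_num)
  · exact (continuous_fourier_of_integrable hf).locallyIntegrable
  intro g hg hgc
  have hg₁ : HasCompactSupport (Complex.ofRealCLM ∘ g) := hgc.comp_left rfl
  have hg₂ : ContDiff ℝ (⊤ : ℕ∞) (Complex.ofRealCLM ∘ g) :=
    Complex.ofRealCLM.contDiff.comp hg
  set φ : 𝓢(ℝ, ℂ) := hg₁.toSchwartzMap hg₂
  have hφ : ∀ x, φ x = (g x : ℂ) := fun x => rfl
  have h1 : ∫ x, (𝓕 φ) x • (hf2.toLp f) x =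
      ∫ x, φ x • (𝓕 (hf2.toLp f) : Lp ℂ 2 (volume : Measure ℝ)) x := by
    rw [← Lp.toTemperedDistribution_apply, ← Lp.toTemperedDistribution_apply,
      ← Lp.fourier_toTemperedDistribution_eq (hf2.toLp f)]
    rfl
  have h2 : ∫ x, (𝓕 φ) x • (hf2.toLp f) x = ∫ x, (𝓕 φ) x • f x :=
    integral_congr_ae (by filter_upwards [hf2.coeFn_toLp] with x hx; rw [hx])
  have h3 := VectorFourier.integral_fourierIntegral_smul_eq_flip (μ := (volume : Measure ℝ))
    (ν := (volume : Measure ℝ)) (L := innerₗ ℝ) Real.continuous_fourierChar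
    (innerSL ℝ).continuous₂ φ.integrable hf
  rw [flip_innerₗ] at h3
  rw [h2] at h1
  simp only [hφ] at h1
  calc _ = _ := h1.symm
    _ = _ := h3

lemma lintegral_enorm_sq_eq {f : ℝ → ℂ} (hf2 : MemLp f 2) :
    ∫⁻ x, ‖f x‖ₑ ^ 2 = ‖hf2.toLp f‖ₑ ^ 2 := by
  rw [Lp.enorm_toLp, eLpNorm_eq_lintegral_rpow_enorm_toReal (by norm_num) (by norm_num),
    ← ENNReal.rpow_natCast, ← ENNReal.rpow_mul]
  simp

/-- Plancherel's identity for the Fourier integral. -/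
lemma lintegral_enorm_fourier_sq {f : ℝ → ℂ} (hf : Integrable f) (hf2 : MemLp f 2) :
    ∫⁻ τ, ‖𝓕 f τ‖ₑ ^ 2 = ∫⁻ t, ‖f t‖ₑ ^ 2 := by
  have h := fourier_toLp_ae_eq hf hf2
  have hm : MemLp (𝓕 f) 2 := (memLp_congr_ae h).1 (Lp.memLp _)
  have e : hm.toLp (𝓕 f) = 𝓕 (hf2.toLp f) := by
    apply Lp.ext
    exact hm.coeFn_toLp.trans h.symm
  rw [lintegral_enorm_sq_eq hf2, lintegral_enorm_sq_eq hm, e, ← ofReal_norm, ← ofReal_norm,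
    Lp.norm_fourier_eq]

/-! ### Superpositions of decaying kernels -/

/-- A kernel `m(ξ, t)` that decays in `t` like `A κ^p e^{-a κ |t|}` with `κ = 1 + (2πξ)²`. -/
structure LaplaceKernel (a A p : ℝ) (m : ℝ → ℝ → ℂ) : Prop where
  measurable : Measurable (Function.uncurry m)
  bound : ∀ ξ t, ‖m ξ t‖ ≤ A * (kap ξ ^ p * Real.exp (-(a * kap ξ * |t|)))

/-- The superposition `t ↦ ∫ g(ξ) m(ξ, t) dξ`. -/
def superpose (g : ℝ → ℂ) (m : ℝ → ℝ → ℂ) (t : ℝ) : ℂ := ∫ ξ, g ξ * m ξ t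

/-- The squared norm of `g` in `L²` with weight `κ^q`. -/
def weightedSq (q : ℝ) (g : ℝ → ℂ) : ℝ≥0∞ := ∫⁻ ξ, ‖g ξ‖ₑ ^ 2 * ENNReal.ofReal (kap ξ ^ q)

lemma weightedSq_mono {q r : ℝ} (h : q ≤ r) (g : ℝ → ℂ) : weightedSq q g ≤ weightedSq r g := by
  apply lintegral_mono
  intro ξ
  dsimp only
  gcongr
  exact one_le_kap ξ

lemma lintegral_exp_abs {r : ℝ} (hr : 0 < r) :
    ∫⁻ t : ℝ, ENNReal.ofReal (Real.exp (-(r * |t|))) = ENNReal.ofReal (2 / r) := by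
  have hg := integral_exp_mul_Ioi (a := -r) (by linarith) 0
  have hc := integral_comp_abs (f := fun t : ℝ => Real.exp (-(r * t)))
  simp only [neg_mul] at hg
  rw [hg] at hc
  have hc' : ∫ t : ℝ, Real.exp (-(r * |t|)) = 2 / r := by
    rw [hc]; simp; field_simp
  have hI : Integrable (fun t : ℝ => Real.exp (-(r * |t|))) := by
    apply MeasureTheory.Integrable.of_integral_ne_zero
    rw [hc']; positivity
  rw [lintegral_ofReal_eq hI (fun t => (Real.exp_pos _).le), hc']

lemma lintegral_kap_rpow_lt_top : ∫⁻ ξ, ENNReal.ofReal (kap ξ ^ (-(3 / 2) : ℝ)) < ⊤ := by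
  have h : Integrable (fun x : ℝ => ((1 : ℝ) + ‖x‖ ^ 2) ^ (-3 / 2 : ℝ)) :=
    integrable_rpow_neg_one_add_norm_sq (r := 3) (by simp)
  have h2 := h.comp_mul_left' (R := 2 * Real.pi) (by positivity)
  have h3 : Integrable (fun ξ : ℝ => kap ξ ^ (-(3 / 2) : ℝ)) := by
    refine h2.congr (ae_of_all _ fun ξ => ?_)
    simp only [kap, Real.norm_eq_abs, sq_abs]
    norm_num
  exact h3.lintegral_lt_top

namespace LaplaceKernel

variable {a A p : ℝ} {m : ℝ → ℝ → ℂ}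

lemma nonneg (hm : LaplaceKernel a A p m) : 0 ≤ A := by
  have := (norm_nonneg _).trans (hm.bound 0 0)
  have h1 := Real.rpow_pos_of_pos (kap_pos 0) p
  have h2 := Real.exp_pos (-(a * kap 0 * |0|))
  by_contra h
  nlinarith [mul_pos h1 h2]

lemma enorm_mul_le (hm : LaplaceKernel a A p m) (g : ℝ → ℂ) (ξ t : ℝ) :
    ‖g ξ * m ξ t‖ₑ ≤ ENNReal.ofReal A *
      (‖g ξ‖ₑ * ENNReal.ofReal (kap ξ ^ p * Real.exp (-(a * kap ξ * |t|)))) := by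
  rw [enorm_mul, mul_left_comm, ← ENNReal.ofReal_mul hm.nonneg]
  gcongr
  rw [← ofReal_norm]
  exact ENNReal.ofReal_le_ofReal (hm.bound ξ t)

/-- The `L²` bound for superpositions: the weight gains `κ^{-1/2}` over the size of the kernel. -/
lemma lintegral_superpose_sq_le (hm : LaplaceKernel a A p m) (ha : 0 < a) {g : ℝ → ℂ}
    (hg : AEStronglyMeasurable g) :
    ∫⁻ t, ‖superpose g m t‖ₑ ^ 2 ≤ ENNReal.ofReal (A ^ 2 / a) * weightedSq (2 * p - 1 / 2) g := by
  calc _ ≤ ∫⁻ t, ENNReal.ofReal A ^ 2 * (∫⁻ ξ, ‖g ξ‖ₑ *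
        ENNReal.ofReal (kap ξ ^ p * Real.exp (-(a * kap ξ * |t|)))) ^ 2 := by
        apply lintegral_mono
        intro t
        dsimp only
        rw [← mul_pow, ← lintegral_const_mul' _ _ ENNReal.ofReal_ne_top]
        gcongr
        exact (enorm_integral_le_lintegral_enorm _).trans
          (lintegral_mono fun ξ => hm.enorm_mul_le g ξ t)
    _ ≤ _ := by
        rw [lintegral_const_mul' _ _ (by simp)]
        refine (mul_le_mul_right (lintegral_sq_laplace_le ha p hg.enorm) _).trans (le_of_eq ?_)
        rw [← mul_assoc, ← ENNReal.ofReal_pow hm.nonneg, ← ENNReal.ofReal_mul (by positivity),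
          weightedSq, mul_one_div]

lemma integrable_prod (hm : LaplaceKernel a A p m) (ha : 0 < a) {g : ℝ → ℂ}
    (hg : AEStronglyMeasurable g) (hgw : weightedSq (2 * p - 1 / 2) g < ⊤) :
    Integrable (fun z : ℝ × ℝ => g z.1 * m z.1 z.2) (volume.prod volume) := by
  have hmeas : AEStronglyMeasurable (fun z : ℝ × ℝ => g z.1 * m z.1 z.2) (volume.prod volume) :=
    hg.comp_fst.mul hm.measurable.aestronglyMeasurable
  refine ⟨hmeas, ?_⟩
  -- the integral in `t` gains `κ⁻¹`, of which `κ ^ (-3/4)` is spent on Cauchy-Schwarz in `ξ`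
  have hle : ∫⁻ z : ℝ × ℝ, ‖g z.1 * m z.1 z.2‖ₑ ∂(volume.prod volume) ≤
      ENNReal.ofReal (A * (2 / a)) * ∫⁻ ξ, (‖g ξ‖ₑ * ENNReal.ofReal (kap ξ ^ (p - 1 / 4))) *
        ENNReal.ofReal (kap ξ ^ (-(3 / 4) : ℝ)) := by
    rw [lintegral_prod _ hmeas.enorm,
      ← lintegral_const_mul' _ _ ENNReal.ofReal_ne_top]
    apply lintegral_mono
    intro ξ
    have hk := kap_pos ξ
    have hA := hm.nonneg
    dsimp only
    calc _ ≤ ∫⁻ t, ENNReal.ofReal A * (‖g ξ‖ₑ * ENNReal.ofReal (kap ξ ^ p)) *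
          ENNReal.ofReal (Real.exp (-(a * kap ξ * |t|))) := by
          apply lintegral_mono
          intro t
          refine (hm.enorm_mul_le g ξ t).trans (le_of_eq ?_)
          rw [ENNReal.ofReal_mul (by positivity)]
          ring
      _ = _ := by
          rw [lintegral_const_mul _ (by fun_prop), lintegral_exp_abs (mul_pos ha hk),
            mul_assoc (‖g ξ‖ₑ), ← ENNReal.ofReal_mul (by positivity), mul_left_comm,
            mul_assoc (‖g ξ‖ₑ), ← ENNReal.ofReal_mul (by positivity),
            ← ENNReal.ofReal_mul (by positivity), mul_left_comm (ENNReal.ofReal _),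
            ← ENNReal.ofReal_mul (by positivity)]
          congr 2
          rw [← Real.rpow_add hk, show p - 1 / 4 + -(3 / 4) = p - 1 by ring, Real.rpow_sub hk,
            Real.rpow_one]
          field_simp
  refine hle.trans_lt (ENNReal.mul_lt_top ENNReal.ofReal_lt_top ?_)
  refine (ENNReal.pow_lt_top_iff.1 (?_ : _ ^ 2 < ⊤)).resolve_right two_ne_zero
  refine (sq_lintegral_mul_le (by fun_prop) (by fun_prop)).trans_lt (ENNReal.mul_lt_top ?_ ?_)
  · refine lt_of_eq_of_lt ?_ hgw
    unfold weightedSq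
    congr 1; ext ξ
    have hk := kap_pos ξ
    rw [mul_pow, ← ENNReal.ofReal_pow (by positivity), ← Real.rpow_natCast, ← Real.rpow_mul hk.le]
    congr 3; push_cast; ring
  · refine lt_of_eq_of_lt ?_ lintegral_kap_rpow_lt_top
    congr 1; ext ξ
    have hk := kap_pos ξ
    rw [← ENNReal.ofReal_pow (by positivity), ← Real.rpow_natCast, ← Real.rpow_mul hk.le]
    congr 2; push_cast; ring

lemma integrable_superpose (hm : LaplaceKernel a A p m) (ha : 0 < a) {g : ℝ → ℂ}
    (hg : AEStronglyMeasurable g) (hgw : weightedSq (2 * p - 1 / 2) g < ⊤) :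
    Integrable (superpose g m) :=
  (hm.integrable_prod ha hg hgw).integral_prod_right

lemma memLp_superpose (hm : LaplaceKernel a A p m) (ha : 0 < a) {g : ℝ → ℂ}
    (hg : AEStronglyMeasurable g) (hgw : weightedSq (2 * p - 1 / 2) g < ⊤) :
    MemLp (superpose g m) 2 := by
  refine ⟨(hm.integrable_superpose ha hg hgw).1, ?_⟩
  rw [eLpNorm_lt_top_iff_lintegral_rpow_enorm_lt_top (by norm_num) (by norm_num)]
  simpa using (hm.lintegral_superpose_sq_le ha hg).trans_lt
    (ENNReal.mul_lt_top ENNReal.ofReal_lt_top hgw)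

lemma integrable_twisted (hm : LaplaceKernel a A p m) (ha : 0 < a) {g : ℝ → ℂ}
    (hg : AEStronglyMeasurable g) (hgw : weightedSq (2 * p - 1 / 2) g < ⊤) (τ : ℝ) :
    Integrable (fun z : ℝ × ℝ => Real.fourierChar (-(z.2 * τ)) • (g z.1 * m z.1 z.2))
      (volume.prod volume) := by
  have h := hm.integrable_prod ha hg hgw
  have hc : Continuous fun z : ℝ × ℝ => Real.fourierChar (-(z.2 * τ)) :=
    Real.continuous_fourierChar.comp (by fun_prop)
  exact h.mono (hc.aestronglyMeasurable.smul h.1)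
    (ae_of_all _ fun z => (Circle.norm_smul _ _).le)

lemma integral_fourierChar_smul (g : ℝ → ℂ) (m : ℝ → ℝ → ℂ) (ξ τ : ℝ) :
    ∫ t, Real.fourierChar (-(t * τ)) • (g ξ * m ξ t) = g ξ * 𝓕 (m ξ) τ := by
  rw [Real.fourier_real_eq, ← integral_const_mul]
  congr 1; ext t
  rw [Circle.smul_def, Circle.smul_def, smul_eq_mul, smul_eq_mul]
  ring

lemma fourier_superpose (hm : LaplaceKernel a A p m) (ha : 0 < a) {g : ℝ → ℂ}
    (hg : AEStronglyMeasurable g) (hgw : weightedSq (2 * p - 1 / 2) g < ⊤) (τ : ℝ) :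
    Integrable (fun ξ => g ξ * 𝓕 (m ξ) τ) ∧
      𝓕 (superpose g m) τ = ∫ ξ, g ξ * 𝓕 (m ξ) τ := by
  have h := hm.integrable_twisted ha hg hgw τ
  constructor
  · have := h.integral_prod_left
    simpa only [integral_fourierChar_smul] using this
  · simp_rw [← integral_fourierChar_smul]
    rw [integral_integral_swap h, Real.fourier_real_eq]
    congr 1; ext t
    unfold superpose
    rw [Circle.smul_def, smul_eq_mul, ← integral_const_mul]
    simp only [Circle.smul_def, smul_eq_mul]

lemma lintegral_fourier_superpose_sq_le (hm : LaplaceKernel a A p m) (ha : 0 < a) {g : ℝ → ℂ}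
    (hg : AEStronglyMeasurable g) (hgw : weightedSq (2 * p - 1 / 2) g < ⊤) :
    ∫⁻ τ, ‖𝓕 (superpose g m) τ‖ₑ ^ 2 ≤
      ENNReal.ofReal (A ^ 2 / a) * weightedSq (2 * p - 1 / 2) g := by
  rw [lintegral_enorm_fourier_sq (hm.integrable_superpose ha hg hgw)
    (hm.memLp_superpose ha hg hgw)]
  exact hm.lintegral_superpose_sq_le ha hg

end LaplaceKernel

/-- The upper endpoint of the interpolation: `n` time derivatives in `L²`. -/
lemma lintegral_fourier_superpose_kap_pow_le {a A : ℝ} {n : ℕ} {m h : ℝ → ℝ → ℂ} (ha : 0 < a)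
    (hm : LaplaceKernel a A 0 m) (hh : LaplaceKernel a A n h)
    (hF : ∀ ξ τ, 𝓕 (h ξ) τ = (2 * Real.pi * Complex.I * τ) ^ n * 𝓕 (m ξ) τ) {g : ℝ → ℂ}
    (hg : AEStronglyMeasurable g) (hgw : weightedSq (2 * n - 1 / 2) g < ⊤) :
    ∫⁻ τ, ‖𝓕 (superpose g m) τ‖ₑ ^ 2 * ENNReal.ofReal (kap τ ^ (n : ℝ)) ≤
      ENNReal.ofReal (2 ^ (n + 1)) * (ENNReal.ofReal (A ^ 2 / a) * weightedSq (2 * n - 1 / 2) g) := by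
  have hmono : weightedSq (2 * 0 - 1 / 2) g ≤ weightedSq (2 * n - 1 / 2) g :=
    weightedSq_mono (by simp) g
  have hgw0 := hmono.trans_lt hgw
  have e : ∀ τ, 𝓕 (superpose g h) τ = (2 * Real.pi * Complex.I * τ) ^ n * 𝓕 (superpose g m) τ := by
    intro τ
    rw [(hm.fourier_superpose ha hg hgw0 τ).2, (hh.fourier_superpose ha hg hgw τ).2,
      ← integral_const_mul]
    congr 1; ext ξ
    rw [hF]; ring
  have h0 := hm.lintegral_fourier_superpose_sq_le ha hg hgw0
  have hn := hh.lintegral_fourier_superpose_sq_le ha hg hgw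
  have hmeas : Measurable (𝓕 (superpose g m)) :=
    (continuous_fourier_of_integrable (hm.integrable_superpose ha hg hgw0)).measurable
  -- `(1 + (2πτ)²)^n` is at most `2^n (1 + (2πτ)^{2n})`
  have hpt : ∀ τ, ‖𝓕 (superpose g m) τ‖ₑ ^ 2 * ENNReal.ofReal (kap τ ^ (n : ℝ)) ≤
      ENNReal.ofReal (2 ^ n) *
        (‖𝓕 (superpose g m) τ‖ₑ ^ 2 + ‖𝓕 (superpose g h) τ‖ₑ ^ 2) := by
    intro τ
    have hk : kap τ ^ n ≤ 2 ^ n * (1 + ((2 * Real.pi * τ) ^ 2) ^ n) := by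
      have := add_pow_le (a := 1) (b := (2 * Real.pi * τ) ^ 2) zero_le_one (sq_nonneg _) n
      rw [one_pow] at this
      refine this.trans ?_
      gcongr
      · norm_num
      · omega
    have hh' : ‖𝓕 (superpose g h) τ‖ₑ ^ 2 =
        ENNReal.ofReal (((2 * Real.pi * τ) ^ 2) ^ n) * ‖𝓕 (superpose g m) τ‖ₑ ^ 2 := by
      rw [e, enorm_mul, mul_pow, enorm_pow, ← ofReal_norm (2 * Real.pi * Complex.I * τ), ← pow_mul,
        mul_comm n 2, pow_mul, ENNReal.ofReal_pow (sq_nonneg _), ← ENNReal.ofReal_pow (norm_nonneg _)]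
      congr 3
      simp [mul_pow]
    rw [hh', Real.rpow_natCast, ← one_add_mul, ← ENNReal.ofReal_one,
      ← ENNReal.ofReal_add zero_le_one (by positivity), ← mul_assoc,
      ← ENNReal.ofReal_mul (by positivity), mul_comm]
    gcongr
  refine (lintegral_mono hpt).trans ?_
  rw [lintegral_const_mul' _ _ ENNReal.ofReal_ne_top, lintegral_add_left (hmeas.enorm.pow_const 2),
    pow_succ, ENNReal.ofReal_mul (by positivity), mul_assoc]
  gcongr
  calc _ ≤ _ := add_le_add (h0.trans (mul_le_mul_right hmono _)) hn
    _ = _ := by rw [← two_mul]; simp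

/-- The main estimate for superpositions: with a kernel of size `e^{-aκ|t|}` whose `n`-th time
derivative has size `κ^n e^{-aκ|t|}`, the superposition lies in `H^σ`, `0 ≤ σ ≤ n`, as soon as the
density lies in `L²` with weight `κ^{2σ - 1/2}`. -/
theorem lintegral_fourier_superpose_le (n : ℕ) (σ : ℝ) (hσ0 : 0 ≤ σ) (hσn : σ ≤ n) :
    ∃ C : ℝ, 0 < C ∧ ∀ (a A : ℝ) (m h : ℝ → ℝ → ℂ), 0 < a → LaplaceKernel a A 0 m →
      LaplaceKernel a A n h →
      (∀ ξ τ, 𝓕 (h ξ) τ = (2 * Real.pi * Complex.I * τ) ^ n * 𝓕 (m ξ) τ) →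
      ∀ g : ℝ → ℂ, AEStronglyMeasurable g → weightedSq (2 * σ - 1 / 2) g < ⊤ →
        ∫⁻ τ, ‖𝓕 (superpose g m) τ‖ₑ ^ 2 * ENNReal.ofReal (kap τ ^ σ) ≤
          ENNReal.ofReal (C * (A ^ 2 / a)) * weightedSq (2 * σ - 1 / 2) g := by
  rcases hσ0.eq_or_lt with rfl | hσ
  · refine ⟨1, one_pos, fun a A m h ha hm hh hF g hg hgw => ?_⟩
    simpa using hm.lintegral_fourier_superpose_sq_le ha hg hgw
  rcases hσn.eq_or_lt with rfl | hσn
  · refine ⟨2 ^ (n + 1), by positivity, fun a A m h ha hm hh hF g hg hgw => ?_⟩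
    rw [ENNReal.ofReal_mul (by positivity), mul_assoc]
    exact lintegral_fourier_superpose_kap_pow_le ha hm hh hF hg hgw
  refine ⟨2 * 2 ^ (n + 1) * (1 + σ / (n - σ)), ?_, fun a A m h ha hm hh hF g hg hgw => ?_⟩
  · have : 0 < (n : ℝ) - σ := by linarith
    positivity
  have hgw0 : weightedSq (2 * 0 - 1 / 2) g < ⊤ :=
    (weightedSq_mono (by linarith) g).trans_lt hgw
  have hcont : Continuous (𝓕 (superpose g m)) :=
    continuous_fourier_of_integrable (hm.integrable_superpose ha hg hgw0)
  have hfin : ∀ ξ, ‖g ξ‖ₑ ^ 2 * ENNReal.ofReal (kap ξ ^ (-(1 / 2) : ℝ)) *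
      ENNReal.ofReal (kap ξ ^ (2 * σ)) = ‖g ξ‖ₑ ^ 2 * ENNReal.ofReal (kap ξ ^ (2 * σ - 1 / 2)) := by
    intro ξ
    have hk := kap_pos ξ
    rw [mul_assoc, ← ENNReal.ofReal_mul (by positivity), ← Real.rpow_add hk]
    congr 3; ring
  -- a time frequency `τ` corresponds to `κ(ξ)` of order `|τ|`, i.e. of order `√κ(τ)`
  have key := lintegral_interpolate (w := kap) (v := fun τ => √(kap τ))
    (f := fun ξ => ‖g ξ‖ₑ ^ 2 * ENNReal.ofReal (kap ξ ^ (-(1 / 2) : ℝ)))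
    (φ := fun τ => ‖𝓕 (superpose g m) τ‖ₑ ^ 2)
    (K := 2 * (ENNReal.ofReal (2 ^ (n + 1)) * ENNReal.ofReal (A ^ 2 / a)))
    (N := n) measurable_kap (by fun_prop) kap_pos (fun τ => Real.sqrt_pos.2 (kap_pos τ))
    (by fun_prop) (hcont.measurable.enorm.pow_const 2).aemeasurable hσ hσn ?_
  · have e1 : ∀ τ, √(kap τ) ^ (2 * σ) = kap τ ^ σ := by
      intro τ
      rw [Real.sqrt_eq_rpow, ← Real.rpow_mul (kap_pos τ).le]
      congr 1; ring
    simp only [e1, hfin] at key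
    refine key.trans (le_of_eq ?_)
    have : 0 < (n : ℝ) - σ := by linarith
    rw [weightedSq, ENNReal.ofReal_mul (by positivity), ENNReal.ofReal_mul (by positivity),
      ENNReal.ofReal_mul (by positivity), ENNReal.ofReal_ofNat]
    ring
  -- the frequencies with `κ > R` are estimated in `L²`, the others with `n` derivatives
  intro R hR
  set S : Set ℝ := {ξ | R < kap ξ} with hS
  have mS : MeasurableSet S := measurableSet_lt measurable_const measurable_kap
  set g₀ : ℝ → ℂ := S.indicator g
  set g₁ : ℝ → ℂ := Sᶜ.indicator g
  have hg₀ : AEStronglyMeasurable g₀ := hg.indicator mS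
  have hg₁ : AEStronglyMeasurable g₁ := hg.indicator mS.compl
  have w₀ : weightedSq (2 * 0 - 1 / 2) g₀ = ∫⁻ x, S.indicator
      (fun ξ => ‖g ξ‖ₑ ^ 2 * ENNReal.ofReal (kap ξ ^ (-(1 / 2) : ℝ))) x := by
    unfold weightedSq
    congr 1; ext ξ
    by_cases h : ξ ∈ S <;> simp [g₀, h]
  have w₁ : weightedSq (2 * n - 1 / 2) g₁ = ∫⁻ x, {ξ | kap ξ ≤ R}.indicator
      (fun ξ => ‖g ξ‖ₑ ^ 2 * ENNReal.ofReal (kap ξ ^ (-(1 / 2) : ℝ)) *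
        ENNReal.ofReal (kap ξ ^ (2 * n : ℝ))) x := by
    have hc : {ξ | kap ξ ≤ R} = Sᶜ := by ext; simp [hS]
    rw [hc]
    unfold weightedSq
    congr 1; ext ξ
    have hk := kap_pos ξ
    by_cases h : ξ ∈ S
    · simp [g₁, h]
    · rw [indicator_of_mem (by exact h), mul_assoc, ← ENNReal.ofReal_mul (by positivity),
        ← Real.rpow_add hk]
      simp only [g₁, indicator_of_mem (show ξ ∈ Sᶜ from h)]
      congr 3; ring
  have f₀ : weightedSq (2 * 0 - 1 / 2) g₀ < ⊤ := by
    refine lt_of_le_of_lt (lintegral_mono fun ξ => ?_) hgw0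
    by_cases h : ξ ∈ S <;> simp [g₀, h]
  have f₁ : weightedSq (2 * n - 1 / 2) g₁ < ⊤ := by
    have : weightedSq (2 * n - 1 / 2) g₁ ≤
        ENNReal.ofReal (R ^ (2 * (n - σ))) * weightedSq (2 * σ - 1 / 2) g := by
      unfold weightedSq
      rw [← lintegral_const_mul' _ _ ENNReal.ofReal_ne_top]
      apply lintegral_mono
      intro ξ
      have hk := kap_pos ξ
      by_cases h : ξ ∈ S
      · simp [g₁, h]
      · have hkR : kap ξ ≤ R := by simpa [hS] using h
        simp only [g₁, indicator_of_mem (show ξ ∈ Sᶜ from h)]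
        rw [mul_left_comm, ← ENNReal.ofReal_mul (by positivity)]
        gcongr
        rw [show (2 * n - 1 / 2 : ℝ) = 2 * (n - σ) + (2 * σ - 1 / 2) by ring, Real.rpow_add hk]
        gcongr
    exact this.trans_lt (ENNReal.mul_lt_top ENNReal.ofReal_lt_top hgw)
  have f₁' : weightedSq (2 * 0 - 1 / 2) g₁ < ⊤ := (weightedSq_mono (by simp) g₁).trans_lt f₁
  have b₀ := hm.lintegral_fourier_superpose_sq_le ha hg₀ f₀
  have b₁ := lintegral_fourier_superpose_kap_pow_le ha hm hh hF hg₁ f₁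
  have split : ∀ τ, 𝓕 (superpose g m) τ = 𝓕 (superpose g₀ m) τ + 𝓕 (superpose g₁ m) τ := by
    intro τ
    have i₀ := hm.fourier_superpose ha hg₀ f₀ τ
    have i₁ := hm.fourier_superpose ha hg₁ f₁' τ
    rw [i₀.2, i₁.2, (hm.fourier_superpose ha hg hgw0 τ).2, ← integral_add i₀.1 i₁.1]
    congr 1; ext ξ
    rw [← add_mul, ← Pi.add_apply g₀ g₁, indicator_self_add_compl]
  have pt : ∀ τ, {y | R ≤ √(kap y)}.indicator (fun τ => ‖𝓕 (superpose g m) τ‖ₑ ^ 2) τ ≤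
      2 * (‖𝓕 (superpose g₀ m) τ‖ₑ ^ 2 + ENNReal.ofReal (R ^ (-(2 * n) : ℝ)) *
        (‖𝓕 (superpose g₁ m) τ‖ₑ ^ 2 * ENNReal.ofReal (kap τ ^ (n : ℝ)))) := by
    intro τ
    by_cases h : R ≤ √(kap τ)
    · rw [indicator_of_mem (by exact h), split]
      have hk := kap_pos τ
      have h1 : 1 ≤ ENNReal.ofReal (R ^ (-(2 * n) : ℝ)) * ENNReal.ofReal (kap τ ^ (n : ℝ)) := by
        rw [← ENNReal.ofReal_mul (by positivity), ← ENNReal.ofReal_one]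
        apply ENNReal.ofReal_le_ofReal
        have h2 : R ^ 2 ≤ kap τ := by
          rw [← Real.sq_sqrt hk.le]
          gcongr
        rw [Real.rpow_neg hR.le, Real.rpow_mul hR.le, Real.rpow_natCast, Real.rpow_natCast,
          Real.rpow_two, ← div_eq_inv_mul, one_le_div (by positivity)]
        gcongr
      have h3 : (‖𝓕 (superpose g₀ m) τ‖ₑ + ‖𝓕 (superpose g₁ m) τ‖ₑ) ^ 2 ≤
          2 * (‖𝓕 (superpose g₀ m) τ‖ₑ ^ 2 + ‖𝓕 (superpose g₁ m) τ‖ₑ ^ 2) := by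
        have := ENNReal.rpow_add_le_mul_rpow_add_rpow (‖𝓕 (superpose g₀ m) τ‖ₑ)
          (‖𝓕 (superpose g₁ m) τ‖ₑ) (p := 2) (by norm_num)
        norm_num at this
        exact this
      calc _ ≤ _ := pow_le_pow_left' (enorm_add_le _ _) 2
        _ ≤ _ := h3
        _ ≤ _ := by
          gcongr
          rw [mul_left_comm]
          exact le_mul_of_one_le_right' h1
    · rw [indicator_of_notMem (by exact h)]
      exact zero_le
  refine (lintegral_mono pt).trans ?_
  have c₀ : Measurable (𝓕 (superpose g₀ m)) :=
    (continuous_fourier_of_integrable (hm.integrable_superpose ha hg₀ f₀)).measurable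
  rw [lintegral_const_mul' _ _ (by simp), lintegral_add_left (c₀.enorm.pow_const 2),
    lintegral_const_mul' _ _ ENNReal.ofReal_ne_top, ← w₀, ← w₁, mul_assoc]
  gcongr
  rw [mul_add]
  refine add_le_add (b₀.trans ?_) ((mul_le_mul_right b₁ _).trans (le_of_eq (by ring)))
  gcongr
  refine le_mul_of_one_le_left' ?_
  rw [← ENNReal.ofReal_one]
  exact ENNReal.ofReal_le_ofReal (one_le_pow₀ (by norm_num))

/-! ### Extension of functions from an interval to the line -/

/-- A compactly supported smooth function that coincides with `t ^ i / i!` near `0`. -/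
def jetProfile (i : ℕ) (t : ℝ) : ℝ :=
  (⟨1, 2, one_pos, one_lt_two⟩ : ContDiffBump (0 : ℝ)) t * ((i.factorial : ℝ)⁻¹ * t ^ i)

lemma contDiff_jetProfile (i : ℕ) : ContDiff ℝ (⊤ : ℕ∞) (jetProfile i) :=
  (ContDiffBump.contDiff _).mul (contDiff_const.mul (contDiff_id.pow i))

lemma hasDerivAt_iteratedDeriv_jetProfile (i j : ℕ) (t : ℝ) :
    HasDerivAt (iteratedDeriv j (jetProfile i)) (iteratedDeriv (j + 1) (jetProfile i) t) t := by
  rw [iteratedDeriv_succ]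
  exact (((contDiff_jetProfile i).differentiable_iteratedDeriv j
    (by exact_mod_cast WithTop.coe_lt_top j)) t).hasDerivAt

lemma continuous_iteratedDeriv_jetProfile (i j : ℕ) :
    Continuous (iteratedDeriv j (jetProfile i)) :=
  continuous_iff_continuousAt.2 fun t => (hasDerivAt_iteratedDeriv_jetProfile i j t).continuousAt

lemma iteratedDeriv_jetProfile_zero (i j : ℕ) :
    iteratedDeriv j (jetProfile i) 0 = if j = i then 1 else 0 := by
  have h : jetProfile i =ᶠ[𝓝 0] fun t => (i.factorial : ℝ)⁻¹ * t ^ i := by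
    filter_upwards [(⟨1, 2, one_pos, one_lt_two⟩ : ContDiffBump (0 : ℝ)).eventuallyEq_one]
      with t ht
    simp only [jetProfile, ht, Pi.one_apply, one_mul]
  rw [h.iteratedDeriv_eq, iteratedDeriv_const_mul_field, iteratedDeriv_fun_pow_zero]
  split_ifs with hij
  · have := Nat.factorial_ne_zero i
    field_simp
  · simp

lemma hasCompactSupport_iteratedDeriv_jetProfile (i j : ℕ) :
    HasCompactSupport (iteratedDeriv j (jetProfile i)) := by
  induction j with
  | zero =>
    rw [iteratedDeriv_zero]
    exact (ContDiffBump.hasCompactSupport _).mul_right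
  | succ j ih => rw [iteratedDeriv_succ]; exact ih.deriv

/-- The profiles have compact support, hence decay exponentially at any rate. -/
lemma exists_jetProfile_bound (n : ℕ) (a : ℝ) : ∃ C : ℝ, 0 ≤ C ∧ ∀ i < n, ∀ j ≤ n, ∀ t,
    |iteratedDeriv j (jetProfile i) t| ≤ C * Real.exp (-(a * |t|)) := by
  have h : ∀ i j, ∃ C : ℝ, ∀ t, ‖iteratedDeriv j (jetProfile i) t * Real.exp (a * |t|)‖ ≤ C :=
    fun i j => ((hasCompactSupport_iteratedDeriv_jetProfile i j).mul_right).exists_bound_of_continuous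
      ((continuous_iteratedDeriv_jetProfile i j).mul (by fun_prop))
  choose C hC using h
  have hC0 : ∀ i j, 0 ≤ C i j := fun i j => (norm_nonneg _).trans (hC i j 0)
  refine ⟨∑ i ∈ Finset.range n, ∑ j ∈ Finset.range (n + 1), C i j,
    Finset.sum_nonneg fun i _ => Finset.sum_nonneg fun j _ => hC0 i j, fun i hi j hj t => ?_⟩
  have h1 : C i j ≤ ∑ i ∈ Finset.range n, ∑ j ∈ Finset.range (n + 1), C i j :=
    (Finset.single_le_sum (f := fun j => C i j) (fun j _ => hC0 i j)
      (Finset.mem_range.2 (Nat.lt_succ_of_le hj))).trans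
      (Finset.single_le_sum (f := fun i => ∑ j ∈ Finset.range (n + 1), C i j)
        (fun i _ => Finset.sum_nonneg fun j _ => hC0 i j) (Finset.mem_range.2 hi))
  have h2 := (hC i j t).trans h1
  rw [norm_mul, Real.norm_eq_abs, Real.norm_of_nonneg (Real.exp_pos _).le] at h2
  rwa [Real.exp_neg, ← div_eq_mul_inv, le_div_iff₀ (Real.exp_pos _)]

/-- The `j`-th derivative of the function of scale `κ⁻¹` with prescribed derivatives
`c 0, …, c (n - 1)` at `0`. -/
def jetExt (n : ℕ) (κ : ℝ) (c : ℕ → ℂ) (j : ℕ) (t : ℝ) : ℂ :=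
  ∑ i ∈ Finset.range n, c i * ((κ ^ j / κ ^ i * iteratedDeriv j (jetProfile i) (κ * t) : ℝ) : ℂ)

lemma hasDerivAt_jetExt (n : ℕ) (κ : ℝ) (c : ℕ → ℂ) (j : ℕ) (t : ℝ) :
    HasDerivAt (jetExt n κ c j) (jetExt n κ c (j + 1) t) t := by
  apply HasDerivAt.fun_sum
  intro i _
  have h := ((hasDerivAt_iteratedDeriv_jetProfile i j (κ * t)).comp t
    ((hasDerivAt_id t).const_mul κ)).const_mul (κ ^ j / κ ^ i)
  refine (h.ofReal_comp.const_mul (c i)).congr_deriv ?_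
  congr 2
  simp only [pow_succ]
  ring

lemma continuous_jetExt (n : ℕ) (κ : ℝ) (c : ℕ → ℂ) (j : ℕ) : Continuous (jetExt n κ c j) :=
  continuous_iff_continuousAt.2 fun t => (hasDerivAt_jetExt n κ c j t).continuousAt

lemma jetExt_zero {n j : ℕ} (hj : j < n) {κ : ℝ} (hκ : 0 < κ) (c : ℕ → ℂ) :
    jetExt n κ c j 0 = c j := by
  unfold jetExt
  rw [Finset.sum_eq_single_of_mem j (Finset.mem_range.2 hj)]
  · rw [mul_zero, iteratedDeriv_jetProfile_zero, if_pos rfl, div_self (by positivity)]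
    simp
  · intro i _ hij
    rw [mul_zero, iteratedDeriv_jetProfile_zero, if_neg (Ne.symm hij)]
    simp

lemma norm_jetExt_le {n j : ℕ} {C a κ A : ℝ} (hκ : 0 < κ) {c : ℕ → ℂ}
    (hC : ∀ i < n, ∀ t, |iteratedDeriv j (jetProfile i) t| ≤ C * Real.exp (-(a * |t|)))
    (hc : ∀ i < n, ‖c i‖ ≤ A * κ ^ i) (t : ℝ) :
    ‖jetExt n κ c j t‖ ≤ n * C * A * (κ ^ j * Real.exp (-(a * κ * |t|))) := by
  have hterm : ∀ i ∈ Finset.range n,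
      ‖c i * ((κ ^ j / κ ^ i * iteratedDeriv j (jetProfile i) (κ * t) : ℝ) : ℂ)‖ ≤
        C * A * (κ ^ j * Real.exp (-(a * κ * |t|))) := by
    intro i hi
    have hi := Finset.mem_range.1 hi
    have h1 := hC i hi (κ * t)
    rw [abs_mul, abs_of_pos hκ, ← mul_assoc a] at h1
    rw [norm_mul, Complex.norm_real, Real.norm_eq_abs, abs_mul, abs_of_pos (by positivity)]
    calc _ ≤ (A * κ ^ i) * (κ ^ j / κ ^ i * (C * Real.exp (-(a * κ * |t|)))) := by
          apply mul_le_mul (hc i hi) _ (by positivity) ((norm_nonneg _).trans (hc i hi))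
          gcongr
      _ = _ := by field_simp
  refine (norm_sum_le _ _).trans ((Finset.sum_le_sum hterm).trans (le_of_eq ?_))
  simp
  ring

/-- The `j`-th derivative of the extension of `f : [0, T] → ℂ` to the line: outside of `[0, T]` the
jets of `f` at the end points are continued on the scale `κ⁻¹`. For `j < n` it is continuous, for
`j = n` it may jump at `0` and `T`. -/
def glue (n : ℕ) (T κ : ℝ) (hT : 0 ≤ T) (f : ℝ → ℂ) (j : ℕ) (t : ℝ) : ℂ :=
  if t ≤ 0 then jetExt n κ (fun i => iteratedDerivWithin i f (Icc 0 T) 0) j t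
  else if t ≤ T then iteratedDerivWithin j f (Icc 0 T) (projIcc 0 T hT t)
  else jetExt n κ (fun i => iteratedDerivWithin i f (Icc 0 T) T) j (t - T)

section glue

variable {n : ℕ} {T κ : ℝ} (hT : 0 < T) {f : ℝ → ℂ}

lemma continuous_iteratedDerivWithin_projIcc (hf : ContDiffOn ℝ n f (Icc 0 T)) {j : ℕ}
    (hj : j ≤ n) :
    Continuous fun t => iteratedDerivWithin j f (Icc 0 T) (projIcc 0 T hT.le t) := by
  have h : ContinuousOn (iteratedDerivWithin j f (Icc 0 T)) (Icc 0 T) :=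
    hf.continuousOn_iteratedDerivWithin (by exact_mod_cast hj) (uniqueDiffOn_Icc hT)
  exact h.comp_continuous (continuous_subtype_val.comp continuous_projIcc)
    fun t => (projIcc 0 T hT.le t).2

lemma glue_of_mem {j : ℕ} {t : ℝ} (ht : t ∈ Ioc 0 T) :
    glue n T κ hT.le f j t = iteratedDerivWithin j f (Icc 0 T) t := by
  rw [glue, if_neg (not_le.2 ht.1), if_pos ht.2, projIcc_of_mem hT.le ⟨ht.1.le, ht.2⟩]

lemma continuous_glue (hκ : 0 < κ) (hf : ContDiffOn ℝ n f (Icc 0 T)) {j : ℕ} (hj : j < n) :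
    Continuous (glue n T κ hT.le f j) := by
  unfold glue
  refine Continuous.if_le (continuous_jetExt _ _ _ _) ?_ continuous_id continuous_const ?_
  · refine Continuous.if_le (continuous_iteratedDerivWithin_projIcc hT hf hj.le)
      ((continuous_jetExt _ _ _ _).comp (by fun_prop)) continuous_id continuous_const ?_
    rintro t rfl
    simp [jetExt_zero hj hκ]
  · rintro t rfl
    simp [jetExt_zero hj hκ, hT.le]

lemma hasDerivAt_glue (hf : ContDiffOn ℝ n f (Icc 0 T)) {j : ℕ} (hj : j < n) {t : ℝ}
    (h0 : t ≠ 0) (hT' : t ≠ T) :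
    HasDerivAt (glue n T κ hT.le f j) (glue n T κ hT.le f (j + 1) t) t := by
  rcases lt_or_gt_of_ne h0 with h0 | h0
  · rw [glue, if_pos h0.le]
    refine (hasDerivAt_jetExt n κ _ j t).congr_of_eventuallyEq ?_
    filter_upwards [Iio_mem_nhds h0] with r hr
    rw [glue, if_pos (le_of_lt hr)]
  rcases lt_or_gt_of_ne hT' with hT' | hT'
  · rw [glue_of_mem hT ⟨h0, hT'.le⟩]
    have hd : DifferentiableWithinAt ℝ (iteratedDerivWithin j f (Icc 0 T)) (Icc 0 T) t :=
      hf.differentiableOn_iteratedDerivWithin (by exact_mod_cast hj) (uniqueDiffOn_Icc hT) t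
        ⟨h0.le, hT'.le⟩
    have h2 := hd.hasDerivWithinAt.hasDerivAt (Icc_mem_nhds h0 hT')
    rw [← iteratedDerivWithin_succ] at h2
    refine h2.congr_of_eventuallyEq ?_
    filter_upwards [Ioo_mem_nhds h0 hT'] with r hr
    exact glue_of_mem hT ⟨hr.1, hr.2.le⟩
  · rw [glue, if_neg (not_le.2 h0), if_neg (not_le.2 hT')]
    refine ((hasDerivAt_jetExt n κ _ j (t - T)).comp_sub_const t T).congr_of_eventuallyEq ?_
    filter_upwards [Ioi_mem_nhds hT'] with r hr
    rw [glue, if_neg (not_le.2 (hT.trans hr)), if_neg (not_le.2 hr)]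

/-- The extension keeps the exponential bounds, uniformly in `κ` and in the length `T`. -/
lemma norm_glue_le {C a A : ℝ} {j : ℕ} (hκ : 0 < κ) (hj : j ≤ n) (hC0 : 0 ≤ C)
    (hC : ∀ i < n, ∀ t, |iteratedDeriv j (jetProfile i) t| ≤ C * Real.exp (-(a * |t|)))
    (hA : ∀ i ≤ n, ∀ t ∈ Icc 0 T,
      ‖iteratedDerivWithin i f (Icc 0 T) t‖ ≤ A * (κ ^ i * Real.exp (-(a * κ * t)))) (t : ℝ) :
    ‖glue n T κ hT.le f j t‖ ≤ (1 + n * C) * A * (κ ^ j * Real.exp (-(a * κ * |t|))) := by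
  have hA0 : 0 ≤ A := by
    have := (norm_nonneg _).trans (hA 0 (Nat.zero_le _) 0 ⟨le_rfl, hT.le⟩)
    simpa using this
  have hb : 0 ≤ A * (κ ^ j * Real.exp (-(a * κ * |t|))) := by positivity
  have hb' : 0 ≤ n * C * (A * (κ ^ j * Real.exp (-(a * κ * |t|)))) := by positivity
  unfold glue
  split_ifs with h0 h1
  · refine (norm_jetExt_le hκ hC (A := A) (fun i hi => ?_) t).trans ?_
    · simpa using hA i hi.le 0 ⟨le_rfl, hT.le⟩
    · linarith
  · push Not at h0
    rw [projIcc_of_mem hT.le ⟨h0.le, h1⟩]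
    have := hA j hj t ⟨h0.le, h1⟩
    rw [abs_of_pos h0] at *
    linarith
  · push Not at h0 h1
    refine (norm_jetExt_le hκ hC (A := A * Real.exp (-(a * κ * T))) (fun i hi => ?_) (t - T)).trans ?_
    · refine (hA i hi.le T ⟨hT.le, le_rfl⟩).trans (le_of_eq (by ring))
    · have e : Real.exp (-(a * κ * |t|)) =
          Real.exp (-(a * κ * T)) * Real.exp (-(a * κ * |t - T|)) := by
        rw [← Real.exp_add, abs_of_pos h0, abs_of_pos (sub_pos.2 h1)]
        congr 1; ring
      have : 0 ≤ A * (κ ^ j * (Real.exp (-(a * κ * T)) * Real.exp (-(a * κ * |t - T|)))) := by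
        positivity
      rw [e]
      linarith

end glue

lemma integral_eq_zero_of_hasDerivAt_off_countable {G G' : ℝ → ℂ} {s : Set ℝ} (hs : s.Countable)
    (hc : Continuous G) (hd : ∀ t ∉ s, HasDerivAt G (G' t) t) (hi : Integrable G')
    (htop : Tendsto G atTop (𝓝 0)) (hbot : Tendsto G atBot (𝓝 0)) : ∫ t, G' t = 0 := by
  have h1 := intervalIntegral_tendsto_integral hi tendsto_neg_atTop_atBot tendsto_id
  have h2 : ∀ᶠ N : ℝ in atTop, ∫ t in (-N)..N, G' t = G N - G (-N) := by
    filter_upwards [eventually_ge_atTop 0] with N hN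
    exact integral_eq_of_hasDerivAt_off_countable_of_le G G' (by linarith) hs hc.continuousOn
      (fun t ht => hd t ht.2) hi.intervalIntegrable
  have h3 : Tendsto (fun N : ℝ => G N - G (-N)) atTop (𝓝 (0 - 0)) :=
    htop.sub (hbot.comp tendsto_neg_atTop_atBot)
  rw [sub_zero] at h3
  exact tendsto_nhds_unique (h1.congr' h2) h3

/-- Integration by parts for the Fourier transform of a continuous, piecewise differentiable
function. -/
lemma fourier_deriv_off_countable {G G' : ℝ → ℂ} {s : Set ℝ} (hs : s.Countable)
    (hc : Continuous G) (hd : ∀ t ∉ s, HasDerivAt G (G' t) t) (hi : Integrable G)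
    (hi' : Integrable G') (htop : Tendsto G atTop (𝓝 0)) (hbot : Tendsto G atBot (𝓝 0)) (τ : ℝ) :
    𝓕 G' τ = 2 * Real.pi * Complex.I * τ * 𝓕 G τ := by
  set e : ℝ → ℂ := fun t => Complex.exp (-(2 * Real.pi * Complex.I * τ) * t) with he
  have hed : ∀ t, HasDerivAt e (-(2 * Real.pi * Complex.I * τ) * e t) t := by
    intro t
    have := ((Complex.ofRealCLM.hasDerivAt (x := t)).const_mul
      (-(2 * Real.pi * Complex.I * τ))).cexp
    refine this.congr_deriv ?_
    simp [he, mul_comm]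
  have hen : ∀ t, ‖e t‖ = 1 := by
    intro t
    rw [he]
    dsimp only
    rw [show -(2 * Real.pi * Complex.I * τ) * t = ((-(2 * Real.pi * τ * t) : ℝ) : ℂ) * Complex.I by
      push_cast; ring]
    exact Complex.norm_exp_ofReal_mul_I _
  have hec : Continuous e := continuous_iff_continuousAt.2 fun t => (hed t).continuousAt
  have hF : ∀ H : ℝ → ℂ, 𝓕 H τ = ∫ t, e t * H t := by
    intro H
    rw [Real.fourier_real_eq_integral_exp_smul]
    congr 1; ext t
    rw [smul_eq_mul, he]
    congr 2
    push_cast; ring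
  have hint : ∀ {H : ℝ → ℂ}, Integrable H → Integrable fun t => e t * H t := fun hH =>
    hH.bdd_mul (c := 1) hec.aestronglyMeasurable (ae_of_all _ fun t => (hen t).le)
  have hz : ∀ l : Filter ℝ, Tendsto G l (𝓝 0) → Tendsto (fun t => e t * G t) l (𝓝 0) := by
    intro l hl
    rw [tendsto_zero_iff_norm_tendsto_zero] at hl ⊢
    simpa [hen] using hl
  have h0 := integral_eq_zero_of_hasDerivAt_off_countable hs (hec.mul hc)
    (G' := fun t => -(2 * Real.pi * Complex.I * τ) * (e t * G t) + e t * G' t)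
    (fun t ht => ((hed t).mul (hd t ht)).congr_deriv (by ring))
    (((hint hi).const_mul _).add (hint hi')) (hz _ htop) (hz _ hbot)
  rw [integral_add ((hint hi).const_mul _) (hint hi'), integral_const_mul, ← hF, ← hF] at h0
  linear_combination h0

lemma integrable_exp_neg_mul_abs {r : ℝ} (hr : 0 < r) :
    Integrable fun t : ℝ => Real.exp (-(r * |t|)) :=
  ⟨by fun_prop, by
    have := lintegral_exp_abs hr
    simp only [HasFiniteIntegral, Real.enorm_eq_ofReal (Real.exp_pos _).le, this,
      ENNReal.ofReal_lt_top]⟩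

/-- Up to the order `n`, the derivatives of the extension are derivatives on the Fourier side. -/
lemma fourier_glue {n : ℕ} {T κ : ℝ} (hT : 0 < T) {f : ℝ → ℂ} (hκ : 0 < κ)
    (hf : ContDiffOn ℝ n f (Icc 0 T)) {a A : ℝ} (ha : 0 < a)
    (hb : ∀ j ≤ n, ∀ t, ‖glue n T κ hT.le f j t‖ ≤ A * (κ ^ j * Real.exp (-(a * κ * |t|))))
    (hm : ∀ j ≤ n, AEStronglyMeasurable (glue n T κ hT.le f j)) (τ : ℝ) {j : ℕ} (hj : j ≤ n) :
    𝓕 (glue n T κ hT.le f j) τ =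
      (2 * Real.pi * Complex.I * τ) ^ j * 𝓕 (glue n T κ hT.le f 0) τ := by
  have hak : 0 < a * κ := mul_pos ha hκ
  have hi : ∀ j ≤ n, Integrable (glue n T κ hT.le f j) := fun j hj =>
    (((integrable_exp_neg_mul_abs hak).const_mul (κ ^ j)).const_mul A).mono' (hm j hj)
      (ae_of_all _ (hb j hj))
  have hlim : ∀ j ≤ n, ∀ l : Filter ℝ, Tendsto (fun t : ℝ => |t|) l atTop →
      Tendsto (glue n T κ hT.le f j) l (𝓝 0) := by
    intro j hj l hl
    apply squeeze_zero_norm (hb j hj)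
    have : Tendsto (fun t : ℝ => Real.exp (-(a * κ * |t|))) l (𝓝 0) :=
      Real.tendsto_exp_neg_atTop_nhds_zero.comp (hl.const_mul_atTop hak)
    simpa using (this.const_mul (κ ^ j)).const_mul A
  induction j with
  | zero => simp
  | succ j ih =>
    have hj' : j < n := hj
    rw [fourier_deriv_off_countable (s := {0, T}) (by simp) (continuous_glue hT hκ hf hj')
      (fun t ht => hasDerivAt_glue hT hf hj' (fun h => ht (by simp [h])) (fun h => ht (by simp [h])))
      (hi j hj'.le) (hi _ hj) (hlim j hj'.le _ tendsto_abs_atTop_atTop)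
      (hlim j hj'.le _ tendsto_abs_atBot_atTop), ih hj'.le, pow_succ]
    ring

/-! ### The multiplier of the heat equation -/

lemma measurable_iteratedDerivWithin_param {n : ℕ} {T : ℝ} (hT : 0 < T) {F : ℝ → ℝ → ℂ}
    (hF : ∀ ξ, ContDiffOn ℝ n (F ξ) (Icc 0 T))
    (hm : ∀ t ∈ Icc 0 T, Measurable fun ξ => F ξ t) {j : ℕ} (hj : j ≤ n) {t : ℝ}
    (ht : t ∈ Icc 0 T) : Measurable fun ξ => iteratedDerivWithin j (F ξ) (Icc 0 T) t := by
  induction j generalizing t with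
  | zero => simpa using hm t ht
  | succ j ih =>
    have hacc : AccPt t (𝓟 (Icc 0 T)) := (uniqueDiffOn_Icc hT t ht).accPt
    have hne : (𝓝[Icc 0 T \ {t}] t).NeBot := accPt_principal_iff_nhdsWithin.1 hacc
    obtain ⟨u, hu, hus⟩ := exists_seq_forall_of_frequently
      (Filter.Eventually.frequently (p := fun r => r ∈ Icc 0 T \ {t})
        (self_mem_nhdsWithin (s := Icc 0 T \ {t}) (a := t)))
    refine measurable_of_tendsto_metrizable
      (f := fun k ξ => slope (iteratedDerivWithin j (F ξ) (Icc 0 T)) t (u k)) (fun k => ?_)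
      (tendsto_pi_nhds.2 fun ξ => ?_)
    · simp only [slope_def_module]
      exact ((ih (Nat.le_of_succ_le hj) (hus k).1).sub (ih (Nat.le_of_succ_le hj) ht)).const_smul _
    · have hd : DifferentiableWithinAt ℝ (iteratedDerivWithin j (F ξ) (Icc 0 T)) (Icc 0 T) t :=
        (hF ξ).differentiableOn_iteratedDerivWithin (by exact_mod_cast hj)
          (uniqueDiffOn_Icc hT) t ht
      rw [iteratedDerivWithin_succ]
      exact (hasDerivWithinAt_iff_tendsto_slope.1 hd.hasDerivWithinAt).comp hu

lemma measurable_glue {n : ℕ} {T : ℝ} (hT : 0 < T) {F : ℝ → ℝ → ℂ}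
    (hF : ∀ ξ, ContDiffOn ℝ n (F ξ) (Icc 0 T))
    (hm : ∀ t ∈ Icc 0 T, Measurable fun ξ => F ξ t) {j : ℕ} (hj : j ≤ n) :
    Measurable (Function.uncurry fun ξ => glue n T (kap ξ) hT.le (F ξ) j) := by
  have hjet : ∀ t₀ ∈ Icc 0 T, ∀ t₁ : ℝ, Measurable fun z : ℝ × ℝ => jetExt n (kap z.1)
      (fun i => iteratedDerivWithin i (F z.1) (Icc 0 T) t₀) j (z.2 - t₁) := by
    intro t₀ ht₀ t₁
    refine Finset.measurable_fun_sum _ fun i hi => Measurable.mul ?_ ?_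
    · exact (measurable_iteratedDerivWithin_param hT hF hm (Finset.mem_range.1 hi).le ht₀).comp
        measurable_fst
    · have hc := (continuous_iteratedDeriv_jetProfile i j).measurable
      exact Complex.measurable_ofReal.comp (((measurable_kap.comp measurable_fst).pow_const j).div
        ((measurable_kap.comp measurable_fst).pow_const i) |>.mul
        (hc.comp ((measurable_kap.comp measurable_fst).mul (measurable_snd.sub_const t₁))))
  have hmid : Measurable fun z : ℝ × ℝ =>
      iteratedDerivWithin j (F z.1) (Icc 0 T) (projIcc 0 T hT.le z.2) :=
    (measurable_uncurry_of_continuous_of_measurable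
      (u := fun t ξ => iteratedDerivWithin j (F ξ) (Icc 0 T) (projIcc 0 T hT.le t))
      (fun ξ => continuous_iteratedDerivWithin_projIcc hT (hF ξ) hj)
      (fun t => measurable_iteratedDerivWithin_param hT hF hm hj (projIcc 0 T hT.le t).2)).comp
      measurable_swap
  have h0 := hjet 0 ⟨le_rfl, hT.le⟩ 0
  simp only [sub_zero] at h0
  exact Measurable.ite (measurableSet_le measurable_snd measurable_const) h0
    (Measurable.ite (measurableSet_le measurable_snd measurable_const) hmid
      (hjet T ⟨hT.le, le_rfl⟩ T))

/-- The exponent `-k² B(t) + i k C(t)`, `k = 2πξ`, of the solution on the Fourier side. -/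
def phase (B C : ℝ → ℝ) (ξ t : ℝ) : ℂ :=
  -((2 * Real.pi * ξ) ^ 2 : ℝ) * (B t : ℂ) + Complex.I * (2 * Real.pi * ξ : ℝ) * (C t : ℂ)

lemma phase_re (B C : ℝ → ℝ) (ξ t : ℝ) :
    (phase B C ξ t).re = -((2 * Real.pi * ξ) ^ 2 * B t) := by
  simp only [phase, Complex.add_re, Complex.mul_re, Complex.neg_re, Complex.neg_im,
    Complex.ofReal_re, Complex.ofReal_im, Complex.I_re, Complex.I_im, Complex.mul_im]
  ring

lemma hasDerivWithinAt_phase {B C : ℝ → ℝ} {b c : ℝ} {s : Set ℝ} {t : ℝ}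
    (hB : HasDerivWithinAt B b s t) (hC : HasDerivWithinAt C c s t) (ξ : ℝ) :
    HasDerivWithinAt (phase B C ξ) (-((2 * Real.pi * ξ) ^ 2 : ℝ) * (b : ℂ) +
      Complex.I * (2 * Real.pi * ξ : ℝ) * (c : ℂ)) s t :=
  (hB.ofReal_comp.const_mul _).add (hC.ofReal_comp.const_mul _)

/-- `B` is the primitive of `b` on `[0, T]` that vanishes at `0`. -/
structure IsPrimitive (T : ℝ) (b B : ℝ → ℝ) : Prop where
  zero : B 0 = 0
  hasDerivWithinAt : ∀ t ∈ Icc 0 T, HasDerivWithinAt B (b t) (Icc 0 T) t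

lemma exists_isPrimitive {T : ℝ} (hT : 0 ≤ T) {b : ℝ → ℝ} (hb : ContinuousOn b (Icc 0 T)) :
    ∃ B, IsPrimitive T b B := by
  have hc : Continuous fun t => b (projIcc 0 T hT t) :=
    hb.comp_continuous (continuous_subtype_val.comp continuous_projIcc)
      fun t => (projIcc 0 T hT t).2
  refine ⟨fun t => ∫ r in (0 : ℝ)..t, b (projIcc 0 T hT r), by simp, fun t ht => ?_⟩
  have h := intervalIntegral.integral_hasDerivAt_right (hc.intervalIntegrable 0 t)
    (hc.stronglyMeasurableAtFilter _ _) hc.continuousAt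
  rw [projIcc_of_mem hT ht] at h
  exact h.hasDerivWithinAt

lemma IsPrimitive.continuousOn {T : ℝ} {b B : ℝ → ℝ} (h : IsPrimitive T b B) :
    ContinuousOn B (Icc 0 T) := fun t ht => (h.hasDerivWithinAt t ht).continuousWithinAt

lemma IsPrimitive.le {T b₀ : ℝ} {b B : ℝ → ℝ} (h : IsPrimitive T b B)
    (hb : ∀ t ∈ Icc 0 T, b₀ ≤ b t) {t : ℝ} (ht : t ∈ Icc 0 T) : b₀ * t ≤ B t := by
  have hd : ∀ r ∈ interior (Icc 0 T), HasDerivAt (fun r => B r - b₀ * r) (b r - b₀ * 1) r := by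
    intro r hr
    rw [interior_Icc] at hr
    exact ((h.hasDerivWithinAt r (Ioo_subset_Icc_self hr)).hasDerivAt
      (Icc_mem_nhds hr.1 hr.2)).sub ((hasDerivAt_id r).const_mul b₀)
  have hmono : MonotoneOn (fun r => B r - b₀ * r) (Icc 0 T) := by
    apply monotoneOn_of_deriv_nonneg (convex_Icc 0 T)
    · exact h.continuousOn.sub (by fun_prop)
    · exact fun r hr => (hd r hr).differentiableAt.differentiableWithinAt
    · intro r hr
      rw [(hd r hr).deriv]
      have := hb r (interior_subset hr)
      linarith
  have := hmono ⟨le_rfl, ht.1.trans ht.2⟩ ht ht.1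
  simp only [h.zero, mul_zero, sub_zero] at this
  linarith

section multiplier

variable {n : ℕ} {T b₀ β γ : ℝ} {b c B C : ℝ → ℝ}

lemma derivWithin_phase (hT : 0 < T) (hB : IsPrimitive T b B) (hC : IsPrimitive T c C) (ξ : ℝ) :
    EqOn (derivWithin (phase B C ξ) (Icc 0 T)) (fun t => -((2 * Real.pi * ξ) ^ 2 : ℝ) * (b t : ℂ) +
      Complex.I * (2 * Real.pi * ξ : ℝ) * (c t : ℂ)) (Icc 0 T) := fun t ht =>
  (hasDerivWithinAt_phase (hB.hasDerivWithinAt t ht) (hC.hasDerivWithinAt t ht) ξ).derivWithin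
    (uniqueDiffOn_Icc hT t ht)

lemma contDiffOn_ofReal (hb : ContDiffOn ℝ n b (Icc 0 T)) :
    ContDiffOn ℝ n (fun t => (b t : ℂ)) (Icc 0 T) :=
  Complex.ofRealCLM.contDiff.comp_contDiffOn hb

lemma contDiffOn_phase (hT : 0 < T) (hb : ContDiffOn ℝ n b (Icc 0 T))
    (hc : ContDiffOn ℝ n c (Icc 0 T)) (hB : IsPrimitive T b B) (hC : IsPrimitive T c C) (ξ : ℝ) :
    ContDiffOn ℝ (n + 1) (phase B C ξ) (Icc 0 T) := by
  rw [contDiffOn_succ_iff_derivWithin (uniqueDiffOn_Icc hT)]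
  refine ⟨fun t ht => (hasDerivWithinAt_phase (hB.hasDerivWithinAt t ht)
    (hC.hasDerivWithinAt t ht) ξ).differentiableWithinAt, by simp, ?_⟩
  refine ContDiffOn.congr ?_ (derivWithin_phase hT hB hC ξ)
  exact (contDiffOn_const.mul (contDiffOn_ofReal hb)).add
    (contDiffOn_const.mul (contDiffOn_ofReal hc))

lemma norm_iteratedDerivWithin_ofReal (hT : 0 < T) (hb : ContDiffOn ℝ n b (Icc 0 T)) {i : ℕ}
    (hi : i ≤ n) {t : ℝ} (ht : t ∈ Icc 0 T) :
    ‖iteratedDerivWithin i (fun t => (b t : ℂ)) (Icc 0 T) t‖ =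
      |iteratedDerivWithin i b (Icc 0 T) t| := by
  rw [← Real.norm_eq_abs, ← norm_iteratedFDerivWithin_eq_norm_iteratedDerivWithin,
    ← norm_iteratedFDerivWithin_eq_norm_iteratedDerivWithin]
  exact Complex.ofRealLI.norm_iteratedFDerivWithin_comp_left (hb t ht) (uniqueDiffOn_Icc hT) ht
    (by exact_mod_cast hi)

/-- The derivatives of the phase up to the order `n` involve the coefficients only up to the order
`n - 1`. -/
lemma norm_iteratedDerivWithin_phase_le (hT : 0 < T) (hb : ContDiffOn ℝ n b (Icc 0 T))
    (hc : ContDiffOn ℝ n c (Icc 0 T)) (hB : IsPrimitive T b B) (hC : IsPrimitive T c C)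
    (hβ : ∀ i ≤ n - 1, ∀ t ∈ Icc 0 T, |iteratedDerivWithin i b (Icc 0 T) t| ≤ β)
    (hγ : ∀ i ≤ n - 1, ∀ t ∈ Icc 0 T, |iteratedDerivWithin i c (Icc 0 T) t| ≤ γ) (ξ : ℝ) {i : ℕ}
    (hi : 1 ≤ i) (hin : i ≤ n) {t : ℝ} (ht : t ∈ Icc 0 T) :
    ‖iteratedDerivWithin i (phase B C ξ) (Icc 0 T) t‖ ≤ ((1 + β + γ) * kap ξ) ^ i := by
  obtain ⟨i, rfl⟩ : ∃ k, i = k + 1 := ⟨i - 1, by omega⟩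
  have hin' : i ≤ n - 1 := by omega
  have hle : (i : WithTop ℕ∞) ≤ n := by exact_mod_cast (by omega : i ≤ n)
  have h1 := hβ i hin' t ht
  have h2 := hγ i hin' t ht
  have hβ0 := (abs_nonneg _).trans h1
  have hγ0 := (abs_nonneg _).trans h2
  have hk := one_le_kap ξ
  have hsq : (2 * Real.pi * ξ) ^ 2 ≤ kap ξ := by unfold kap; linarith
  have hab : |2 * Real.pi * ξ| ≤ kap ξ := by
    unfold kap
    nlinarith [sq_abs (2 * Real.pi * ξ), sq_nonneg (|2 * Real.pi * ξ| - 1)]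
  rw [iteratedDerivWithin_succ', iteratedDerivWithin_congr (derivWithin_phase hT hB hC ξ) ht,
    iteratedDerivWithin_fun_add ht (uniqueDiffOn_Icc hT)
      ((contDiffOn_const.mul (contDiffOn_ofReal hb)).of_le hle t ht)
      ((contDiffOn_const.mul (contDiffOn_ofReal hc)).of_le hle t ht),
    iteratedDerivWithin_const_mul_field, iteratedDerivWithin_const_mul_field]
  calc _ ≤ kap ξ * β + kap ξ * γ := by
        refine (norm_add_le _ _).trans (add_le_add ?_ ?_)
        · rw [norm_mul, norm_neg, Complex.norm_real, Real.norm_of_nonneg (sq_nonneg _),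
            norm_iteratedDerivWithin_ofReal hT hb (by omega) ht]
          gcongr
        · rw [norm_mul, norm_mul, Complex.norm_I, one_mul, Complex.norm_real, Real.norm_eq_abs,
            norm_iteratedDerivWithin_ofReal hT hc (by omega) ht]
          gcongr
    _ ≤ (1 + β + γ) * kap ξ := by nlinarith
    _ ≤ _ := le_self_pow₀ (by nlinarith [mul_nonneg hβ0 (sub_nonneg.2 hk)]) (Nat.succ_ne_zero i)

lemma norm_iteratedFDeriv_cexp (i : ℕ) (z : ℂ) :
    ‖iteratedFDeriv ℝ i Complex.exp z‖ = Real.exp z.re := by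
  rw [← (Complex.contDiff_exp (𝕜 := ℂ) (n := i)).contDiffAt.restrictScalars_iteratedFDeriv (𝕜 := ℝ),
    Function.comp_apply, ContinuousMultilinearMap.norm_restrictScalars,
    norm_iteratedFDeriv_eq_norm_iteratedDeriv, iteratedDeriv_eq_iterate, Complex.iter_deriv_exp,
    Complex.norm_exp]

lemma contDiffOn_exp_phase (hT : 0 < T) (hb : ContDiffOn ℝ n b (Icc 0 T))
    (hc : ContDiffOn ℝ n c (Icc 0 T)) (hB : IsPrimitive T b B) (hC : IsPrimitive T c C) (ξ : ℝ) :
    ContDiffOn ℝ n (fun t => Complex.exp (phase B C ξ t)) (Icc 0 T) :=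
  Complex.contDiff_exp.comp_contDiffOn
    ((contDiffOn_phase hT hb hc hB hC ξ).of_le (by exact_mod_cast Nat.le_succ n))

lemma norm_iteratedDerivWithin_exp_phase_le (hb₀ : 0 < b₀) (hT : 0 < T)
    (hb : ContDiffOn ℝ n b (Icc 0 T)) (hc : ContDiffOn ℝ n c (Icc 0 T)) (hB : IsPrimitive T b B)
    (hC : IsPrimitive T c C) (hbb : ∀ t ∈ Icc 0 T, b₀ ≤ b t) (hβ0 : 0 ≤ β) (hγ0 : 0 ≤ γ)
    (hβ : ∀ i ≤ n - 1, ∀ t ∈ Icc 0 T, |iteratedDerivWithin i b (Icc 0 T) t| ≤ β)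
    (hγ : ∀ i ≤ n - 1, ∀ t ∈ Icc 0 T, |iteratedDerivWithin i c (Icc 0 T) t| ≤ γ) (ξ : ℝ) {j : ℕ}
    (hj : j ≤ n) {t : ℝ} (ht : t ∈ Icc 0 T) :
    ‖iteratedDerivWithin j (fun t => Complex.exp (phase B C ξ t)) (Icc 0 T) t‖ ≤
      (n.factorial * Real.exp (b₀ * T) * (1 + β + γ) ^ n) *
        (kap ξ ^ j * Real.exp (-(b₀ * kap ξ * t))) := by
  have hk := one_le_kap ξ
  have h := norm_iteratedFDerivWithin_comp_le (𝕜 := ℝ) (n := j) (N := n) (g := Complex.exp)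
    (f := phase B C ξ) (s := Icc 0 T) (t := univ) (x := t) (C := Real.exp (phase B C ξ t).re)
    (D := (1 + β + γ) * kap ξ) Complex.contDiff_exp.contDiffOn
    ((contDiffOn_phase hT hb hc hB hC ξ).of_le (by exact_mod_cast Nat.le_succ n))
    (by exact_mod_cast hj) uniqueDiffOn_univ (uniqueDiffOn_Icc hT) (mapsTo_univ _ _) ht
    (fun i _ => by rw [iteratedFDerivWithin_univ, norm_iteratedFDeriv_cexp])
    (fun i hi hij => by
      rw [norm_iteratedFDerivWithin_eq_norm_iteratedDerivWithin]
      exact norm_iteratedDerivWithin_phase_le hT hb hc hB hC hβ hγ ξ hi (hij.trans hj) ht)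
  rw [norm_iteratedFDerivWithin_eq_norm_iteratedDerivWithin] at h
  refine h.trans ?_
  -- low frequencies cost the factor `e^{b₀ T}`, which stays bounded for small `T`
  have hexp : Real.exp (phase B C ξ t).re ≤ Real.exp (b₀ * T) * Real.exp (-(b₀ * kap ξ * t)) := by
    rw [← Real.exp_add, phase_re]
    apply Real.exp_le_exp.2
    have h1 := hB.le hbb ht
    have h2 := ht.2
    unfold kap
    nlinarith [mul_le_mul_of_nonneg_left h1 (sq_nonneg (2 * Real.pi * ξ)),
      mul_le_mul_of_nonneg_left h2 hb₀.le]
  have hfac : (j.factorial : ℝ) ≤ n.factorial := by exact_mod_cast Nat.factorial_le hj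
  have hpow : (1 + β + γ) ^ j ≤ (1 + β + γ) ^ n := pow_le_pow_right₀ (by linarith) hj
  calc _ ≤ (n.factorial : ℝ) * (Real.exp (b₀ * T) * Real.exp (-(b₀ * kap ξ * t))) *
        ((1 + β + γ) ^ n * kap ξ ^ j) := by
        rw [mul_pow]
        gcongr
    _ = _ := by ring

end multiplier

/-- The multiplier `exp (-k² B + i k C)` extends from `0 < t ≤ T` to a kernel on the line. -/
theorem exists_kernel (n : ℕ) (b₀ : ℝ) (hb₀ : 0 < b₀) :
    ∃ K : ℝ, 0 < K ∧ ∀ (T β γ : ℝ) (b c B C : ℝ → ℝ), 0 < T → 0 ≤ β → 0 ≤ γ →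
      ContDiffOn ℝ n b (Icc 0 T) → ContDiffOn ℝ n c (Icc 0 T) → IsPrimitive T b B →
      IsPrimitive T c C → (∀ t ∈ Icc 0 T, b₀ ≤ b t) →
      (∀ i ≤ n - 1, ∀ t ∈ Icc 0 T, |iteratedDerivWithin i b (Icc 0 T) t| ≤ β) →
      (∀ i ≤ n - 1, ∀ t ∈ Icc 0 T, |iteratedDerivWithin i c (Icc 0 T) t| ≤ γ) →
      ∃ m h : ℝ → ℝ → ℂ,
        LaplaceKernel b₀ (K * (Real.exp (b₀ * T) * (1 + β + γ) ^ n)) 0 m ∧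
        LaplaceKernel b₀ (K * (Real.exp (b₀ * T) * (1 + β + γ) ^ n)) n h ∧
        (∀ ξ τ, 𝓕 (h ξ) τ = (2 * Real.pi * Complex.I * τ) ^ n * 𝓕 (m ξ) τ) ∧
        ∀ ξ, ∀ t ∈ Ioc 0 T, m ξ t = Complex.exp (phase B C ξ t) := by
  obtain ⟨M, hM0, hM⟩ := exists_jetProfile_bound n b₀
  refine ⟨(1 + n * M) * n.factorial, by positivity, ?_⟩
  intro T β γ b c B C hT hβ0 hγ0 hb hc hB hC hbb hβ hγ
  set F : ℝ → ℝ → ℂ := fun ξ t => Complex.exp (phase B C ξ t) with hF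
  have hFc : ∀ ξ, ContDiffOn ℝ n (F ξ) (Icc 0 T) := contDiffOn_exp_phase hT hb hc hB hC
  have hFm : ∀ t ∈ Icc 0 T, Measurable fun ξ => F ξ t := fun t _ => by
    simp only [hF, phase]
    fun_prop
  have hbound : ∀ ξ, ∀ j ≤ n, ∀ t, ‖glue n T (kap ξ) hT.le (F ξ) j t‖ ≤
      (1 + n * M) * n.factorial * (Real.exp (b₀ * T) * (1 + β + γ) ^ n) *
        (kap ξ ^ j * Real.exp (-(b₀ * kap ξ * |t|))) := by
    intro ξ j hj t
    refine (norm_glue_le hT (kap_pos ξ) hj hM0 (fun i hi t => hM i hi j hj t)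
      (fun i hi t ht => norm_iteratedDerivWithin_exp_phase_le hb₀ hT hb hc hB hC hbb hβ0 hγ0 hβ hγ
        ξ hi ht) t).trans (le_of_eq (by ring))
  refine ⟨fun ξ => glue n T (kap ξ) hT.le (F ξ) 0, fun ξ => glue n T (kap ξ) hT.le (F ξ) n,
    ⟨measurable_glue hT hFc hFm (Nat.zero_le n), fun ξ t => ?_⟩,
    ⟨measurable_glue hT hFc hFm le_rfl, fun ξ t => ?_⟩, fun ξ τ => ?_, fun ξ t ht => ?_⟩
  · simpa using hbound ξ 0 (Nat.zero_le n) t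
  · simpa using hbound ξ n le_rfl t
  · exact fourier_glue hT (kap_pos ξ) (hFc ξ) hb₀ (hbound ξ) (fun j hj =>
      ((measurable_glue hT hFc hFm hj).comp (measurable_prodMk_left (x := ξ))).aestronglyMeasurable)
      τ le_rfl
  · exact (glue_of_mem hT ht).trans (by rw [iteratedDerivWithin_zero])

/-! ### Tempered distributions with a weighted `L²` density -/

lemma weight_eq (s ξ : ℝ) : weight s ξ = ((kap ξ ^ (s / 2) : ℝ) : ℂ) := rfl

lemma hasTemperateGrowth_weight (s : ℝ) : (weight s).HasTemperateGrowth := by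
  have h1 : (fun x : ℝ => ((1 + ‖x‖ ^ 2) ^ (s / 2) : ℝ)).HasTemperateGrowth := by fun_prop
  have h2 : (fun ξ : ℝ => 2 * Real.pi * ξ).HasTemperateGrowth := by fun_prop
  have h3 : (fun ξ : ℝ => ((1 + ‖2 * Real.pi * ξ‖ ^ 2) ^ (s / 2) : ℝ)).HasTemperateGrowth :=
    h1.comp h2
  have h4 : (fun ξ : ℝ => (((1 + ‖2 * Real.pi * ξ‖ ^ 2) ^ (s / 2) : ℝ) : ℂ)).HasTemperateGrowth := by
    fun_prop
  simp only [Real.norm_eq_abs, sq_abs] at h4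
  exact h4

lemma continuous_weight (s : ℝ) : Continuous (weight s) := (hasTemperateGrowth_weight s).1.continuous

lemma weight_neg_mul_weight (s ξ : ℝ) : weight (-s) ξ * weight s ξ = 1 := by
  rw [weight_eq, weight_eq, ← Complex.ofReal_mul, ← Real.rpow_add (kap_pos ξ)]
  norm_num [neg_div]

lemma enorm_weight_mul_sq (s ξ : ℝ) (z : ℂ) :
    ‖weight s ξ * z‖ₑ ^ 2 = ‖z‖ₑ ^ 2 * ENNReal.ofReal (kap ξ ^ s) := by
  have hk := kap_pos ξ
  rw [enorm_mul, mul_pow, mul_comm, weight_eq, ← ofReal_norm (Complex.ofReal _), Complex.norm_real,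
    Real.norm_of_nonneg (by positivity), ← ENNReal.ofReal_pow (by positivity),
    ← Real.rpow_natCast, ← Real.rpow_mul hk.le]
  congr 3
  push_cast
  ring

/-- The functions in the weighted space `L²(κ^s)`. -/
structure MemWeighted (s : ℝ) (v : ℝ → ℂ) : Prop where
  aestronglyMeasurable : AEStronglyMeasurable v
  weightedSq_lt_top : weightedSq s v < ⊤

namespace MemWeighted

variable {s : ℝ} {v w : ℝ → ℂ}

lemma memLp (hv : MemWeighted s v) : MemLp (fun ξ => weight s ξ * v ξ) 2 := by
  refine ⟨(continuous_weight s).aestronglyMeasurable.mul hv.1, ?_⟩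
  rw [eLpNorm_lt_top_iff_lintegral_rpow_enorm_lt_top (by norm_num) (by norm_num)]
  have := hv.2
  simp only [weightedSq, ← enorm_weight_mul_sq] at this
  simpa using this

lemma of_memLp (hv : MemLp (fun ξ => weight s ξ * v ξ) 2) : MemWeighted s v := by
  have e : v = fun ξ => weight (-s) ξ * (weight s ξ * v ξ) := by
    ext ξ; rw [← mul_assoc, weight_neg_mul_weight, one_mul]
  refine ⟨?_, ?_⟩
  · rw [e]
    exact (continuous_weight _).aestronglyMeasurable.mul hv.1
  · have := hv.2
    rw [eLpNorm_lt_top_iff_lintegral_rpow_enorm_lt_top (by norm_num) (by norm_num)] at this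
    simp only [weightedSq, ← enorm_weight_mul_sq]
    simpa using this

lemma sub (hv : MemWeighted s v) (hw : MemWeighted s w) : MemWeighted s (fun ξ => v ξ - w ξ) := by
  apply of_memLp
  simpa [mul_sub] using! hv.memLp.sub hw.memLp

lemma locallyIntegrable_continuous_mul (hv : MemWeighted s v) {f : ℝ → ℂ} (hf : Continuous f) :
    LocallyIntegrable fun ξ => f ξ * v ξ := by
  have h := hv.memLp.locallyIntegrable (by norm_num)
  rw [← locallyIntegrableOn_univ] at h ⊢
  refine (h.continuousOn_mul (hf.mul (continuous_weight (-s))).continuousOn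
    isOpen_univ.isLocallyClosed).congr (ae_of_all _ fun ξ => ?_)
  change f ξ * weight (-s) ξ * (weight s ξ * v ξ) = f ξ * v ξ
  rw [mul_assoc, ← mul_assoc (weight (-s) ξ), weight_neg_mul_weight, one_mul]

/-- The pairing with a Schwartz function is controlled by the weighted norm. -/
lemma lintegral_schwartz_mul_le (hv : MemWeighted s v) (ψ : 𝓢(ℝ, ℂ)) :
    (∫⁻ ξ, ‖ψ ξ * v ξ‖ₑ) ^ 2 ≤ weightedSq (-s) ψ * weightedSq s v := by
  have e : ∀ ξ, ‖ψ ξ * v ξ‖ₑ = ‖weight (-s) ξ * ψ ξ‖ₑ * ‖weight s ξ * v ξ‖ₑ := by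
    intro ξ
    rw [← enorm_mul, mul_mul_mul_comm, weight_neg_mul_weight, one_mul]
  simp_rw [e]
  refine (sq_lintegral_mul_le ?_ hv.memLp.1.enorm).trans (le_of_eq ?_)
  · exact ((continuous_weight _).mul ψ.continuous).enorm.measurable.aemeasurable
  · simp only [weightedSq, ← enorm_weight_mul_sq]

lemma weightedSq_schwartz_lt_top (r : ℝ) (ψ : 𝓢(ℝ, ℂ)) : weightedSq r ψ < ⊤ := by
  have h := (SchwartzMap.smulLeftCLM ℂ (weight r) ψ).memLp 2 volume
  have e : ⇑(SchwartzMap.smulLeftCLM ℂ (weight r) ψ) = fun ξ => weight r ξ * ψ ξ := by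
    ext ξ
    rw [SchwartzMap.smulLeftCLM_apply_apply (hasTemperateGrowth_weight r), smul_eq_mul]
  rw [e] at h
  exact (of_memLp h).2

lemma integrable_schwartz_mul (hv : MemWeighted s v) (ψ : 𝓢(ℝ, ℂ)) :
    Integrable fun ξ => ψ ξ * v ξ := by
  refine ⟨ψ.continuous.aestronglyMeasurable.mul hv.1, ?_⟩
  have := (hv.lintegral_schwartz_mul_le ψ).trans_lt
    (ENNReal.mul_lt_top (weightedSq_schwartz_lt_top _ ψ) hv.2)
  exact (ENNReal.pow_lt_top_iff.1 this).resolve_right two_ne_zero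

end MemWeighted

/-- The tempered distribution `V` is given by the density `v ∈ L²(κ^s)`. -/
structure HasDensity (s : ℝ) (V : 𝓢'(ℝ, ℂ)) (v : ℝ → ℂ) : Prop where
  memWeighted : MemWeighted s v
  apply_eq : ∀ ψ : 𝓢(ℝ, ℂ), V ψ = ∫ ξ, ψ ξ * v ξ

lemma HasDensity.sub {s : ℝ} {V W : 𝓢'(ℝ, ℂ)} {v w : ℝ → ℂ} (hV : HasDensity s V v)
    (hW : HasDensity s W w) : HasDensity s (V - W) (fun ξ => v ξ - w ξ) := by
  refine ⟨hV.1.sub hW.1, fun ψ => ?_⟩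
  have : (V - W) ψ = V ψ - W ψ := rfl
  rw [this, hV.2, hW.2, ← integral_sub (hV.1.integrable_schwartz_mul ψ)
    (hW.1.integrable_schwartz_mul ψ)]
  simp only [mul_sub]

/-- `MemSobolev` uses the weight `1 + ξ²`, which is comparable to `κ`. -/
lemma exists_hasDensity_of_memSobolev {s : ℝ} {F : 𝓢'(ℝ, ℂ)} (hF : MemSobolev s 2 F) :
    ∃ v, HasDensity s (𝓕 F) v := by
  obtain ⟨f, hf⟩ := memSobolev_iff_exists_smulLeftCLM_fourier.1 hF
  have hg : ∀ r : ℝ, (fun x : ℝ => (((1 + ‖x‖ ^ 2) ^ (r / 2) : ℝ) : ℂ)).HasTemperateGrowth := by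
    intro r; fun_prop
  have hpos : ∀ ξ : ℝ, 0 < 1 + ‖ξ‖ ^ 2 := fun ξ => by positivity
  set v : ℝ → ℂ := fun ξ => (((1 + ‖ξ‖ ^ 2) ^ (-s / 2) : ℝ) : ℂ) * f ξ with hv
  refine ⟨v, ?_, fun ψ => ?_⟩
  · have hvm : AEStronglyMeasurable v :=
      (hg (-s)).1.continuous.aestronglyMeasurable.mul (Lp.aestronglyMeasurable f)
    refine MemWeighted.of_memLp ((Lp.memLp f).of_le_mul (c := (((2 * Real.pi) ^ 2) ^ |s|) ^ (1 / 2 : ℝ))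
      ((continuous_weight s).aestronglyMeasurable.mul hvm) (ae_of_all _ fun ξ => ?_))
    have hk := kap_pos ξ
    rw [hv, ← mul_assoc, weight_eq, ← Complex.ofReal_mul, norm_mul, Complex.norm_real,
      Real.norm_of_nonneg (by have := hpos ξ; positivity)]
    gcongr
    have h1 : 1 ≤ kap ξ / (1 + ‖ξ‖ ^ 2) := by
      rw [one_le_div (hpos ξ)]
      unfold kap
      rw [Real.norm_eq_abs, sq_abs, mul_pow]
      have : 1 ≤ (2 * Real.pi) ^ 2 := one_le_pow₀ (by linarith [Real.pi_gt_three])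
      nlinarith [sq_nonneg ξ]
    have h2 : kap ξ / (1 + ‖ξ‖ ^ 2) ≤ (2 * Real.pi) ^ 2 := by
      rw [div_le_iff₀ (hpos ξ)]
      unfold kap
      rw [Real.norm_eq_abs, sq_abs, mul_pow]
      nlinarith [sq_nonneg ξ, Real.pi_gt_three]
    calc kap ξ ^ (s / 2) * (1 + ‖ξ‖ ^ 2) ^ (-s / 2) = ((kap ξ / (1 + ‖ξ‖ ^ 2)) ^ s) ^ (1 / 2 : ℝ) := by
          rw [← Real.rpow_mul (by positivity), Real.div_rpow hk.le (hpos ξ).le, mul_one_div, neg_div,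
            Real.rpow_neg (hpos ξ).le, ← div_eq_mul_inv]
      _ ≤ ((kap ξ / (1 + ‖ξ‖ ^ 2)) ^ |s|) ^ (1 / 2 : ℝ) := by
          gcongr
          exact le_abs_self s
      _ ≤ _ := by gcongr
  · have e : ψ = SchwartzMap.smulLeftCLM ℂ (fun x : ℝ => (((1 + ‖x‖ ^ 2) ^ (s / 2) : ℝ) : ℂ))
        (SchwartzMap.smulLeftCLM ℂ (fun x : ℝ => (((1 + ‖x‖ ^ 2) ^ (-s / 2) : ℝ) : ℂ)) ψ) := by
      ext ξ
      rw [SchwartzMap.smulLeftCLM_apply_apply (hg s), SchwartzMap.smulLeftCLM_apply_apply (hg (-s)),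
        smul_smul, ← Complex.ofReal_mul, ← Real.rpow_add (hpos ξ)]
      norm_num [neg_div]
    conv_lhs => rw [e]
    rw [← smulLeftCLM_apply_apply, hf, Lp.toTemperedDistribution_apply]
    congr 1; ext ξ
    rw [SchwartzMap.smulLeftCLM_apply_apply (hg (-s)), hv, smul_eq_mul, smul_eq_mul]
    ring

/-- The `H^s` norm of a distribution whose Fourier transform has a density. -/
lemma sobolevENorm_eq_of_hasDensity {s : ℝ} {F : 𝓢'(ℝ, ℂ)} {v : ℝ → ℂ}
    (h : HasDensity s (𝓕 F) v) :
    sobolevENorm s F = ENNReal.ofReal (√(2 * Real.pi)) * weightedSq s v ^ (1 / 2 : ℝ) := by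
  set g₀ : Lp ℂ 2 (volume : Measure ℝ) := h.1.memLp.toLp with hg₀
  have h1 : smulLeftCLM ℂ (weight s) (𝓕 F) = (g₀ : 𝓢'(ℝ, ℂ)) := by
    ext ψ
    rw [smulLeftCLM_apply_apply, h.2, Lp.toTemperedDistribution_apply]
    apply integral_congr_ae
    filter_upwards [h.1.memLp.coeFn_toLp] with ξ hξ
    rw [hg₀, hξ, SchwartzMap.smulLeftCLM_apply_apply (hasTemperateGrowth_weight s), smul_eq_mul,
      smul_eq_mul]
    ring
  have h2 : ‖g₀‖ₑ = weightedSq s v ^ (1 / 2 : ℝ) := by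
    have := lintegral_enorm_sq_eq h.1.memLp
    rw [← hg₀] at this
    simp only [weightedSq, ← enorm_weight_mul_sq]
    rw [this, ← ENNReal.rpow_natCast, ← ENNReal.rpow_mul]
    norm_num
  rw [← h2]
  apply le_antisymm
  · exact iInf₂_le g₀ h1
  · refine le_iInf₂ fun g hg => ?_
    have : g = g₀ := by
      have hinj := LinearMap.ker_eq_bot.1
        (Lp.ker_toTemperedDistributionCLM_eq_bot (F := ℂ) (μ := (volume : Measure ℝ)) (p := 2))
      apply hinj
      change (g : 𝓢'(ℝ, ℂ)) = (g₀ : 𝓢'(ℝ, ℂ))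
      rw [← hg, h1]
    rw [this]

/-! ### The weak solution on the Fourier side -/

open LineDeriv in
lemma derivCLM_eq_lineDerivOp (F : 𝓢'(ℝ, ℂ)) : derivCLM ℂ F = ∂_{(1 : ℝ)} F := by
  ext φ
  rw [derivCLM_apply_apply, lineDerivOp_apply_apply]
  congr 2

/-- Multiplication of a Schwartz function by `2πiξ`. -/
def mulFreq (ψ : 𝓢(ℝ, ℂ)) : 𝓢(ℝ, ℂ) :=
  (2 * Real.pi * Complex.I : ℂ) • SchwartzMap.smulLeftCLM ℂ (fun x : ℝ => ((inner ℝ x 1 : ℝ) : ℂ)) ψ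

lemma mulFreq_apply (ψ : 𝓢(ℝ, ℂ)) (ξ : ℝ) :
    mulFreq ψ ξ = Complex.I * (2 * Real.pi * ξ : ℝ) * ψ ξ := by
  have hg : (fun x : ℝ => ((inner ℝ x 1 : ℝ) : ℂ)).HasTemperateGrowth := by fun_prop
  rw [mulFreq, smul_apply, SchwartzMap.smulLeftCLM_apply_apply hg]
  simp
  ring

lemma fourier_derivCLM_apply (F : 𝓢'(ℝ, ℂ)) (ψ : 𝓢(ℝ, ℂ)) :
    𝓕 (derivCLM ℂ F) ψ = 𝓕 F (mulFreq ψ) := by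
  rw [derivCLM_eq_lineDerivOp, fourier_lineDerivOp_eq, mulFreq, map_smul, ← smulLeftCLM_apply_apply]
  rfl

/-- The time derivative of the phase, i.e. the symbol `-k² b + i k c` of the equation. -/
def symbol (b c ξ : ℝ) : ℂ :=
  -((2 * Real.pi * ξ) ^ 2 : ℝ) * (b : ℂ) + Complex.I * (2 * Real.pi * ξ : ℝ) * (c : ℂ)

/-- The weak equation, tested against a fixed function of the frequency. -/
lemma IsCauchySolution.hasDerivAt_integral {b c : ℝ → ℝ} {T s : ℝ} {U₀ : 𝓢'(ℝ, ℂ)}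
    {U : ℝ → 𝓢'(ℝ, ℂ)} (hU : IsCauchySolution b c T s U₀ U) {v : ℝ → ℝ → ℂ}
    (hv : ∀ t ∈ Icc 0 T, HasDensity s (𝓕 (U t)) (v t)) {t : ℝ} (ht : t ∈ Ioo 0 T)
    (ψ : 𝓢(ℝ, ℂ)) :
    HasDerivAt (fun r => ∫ ξ, ψ ξ * v r ξ) (∫ ξ, symbol (b t) (c t) ξ * ψ ξ * v t ξ) t := by
  have h := hU.equation t ht (𝓕 ψ)
  have htI := Ioo_subset_Icc_self ht
  have e : ((b t : ℂ) • derivCLM ℂ (derivCLM ℂ (U t)) + (c t : ℂ) • derivCLM ℂ (U t)) (𝓕 ψ) =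
      ∫ ξ, symbol (b t) (c t) ξ * ψ ξ * v t ξ := by
    calc _ = (b t : ℂ) * 𝓕 (derivCLM ℂ (derivCLM ℂ (U t))) ψ +
          (c t : ℂ) * 𝓕 (derivCLM ℂ (U t)) ψ := rfl
      _ = _ := by
        rw [fourier_derivCLM_apply, fourier_derivCLM_apply, fourier_derivCLM_apply,
          (hv t htI).2, (hv t htI).2, ← integral_const_mul, ← integral_const_mul, ← integral_add
            (((hv t htI).1.integrable_schwartz_mul _).const_mul _)
            (((hv t htI).1.integrable_schwartz_mul _).const_mul _)]
        congr 1; ext ξ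
        rw [mulFreq_apply, mulFreq_apply, symbol]
        push_cast
        linear_combination ((b t : ℂ) * (2 * Real.pi * ξ) ^ 2 * ψ ξ * v t ξ) * Complex.I_sq
  rw [e] at h
  refine h.congr_of_eventuallyEq ?_
  filter_upwards [Icc_mem_nhds ht.1 ht.2] with r hr
  rw [← (hv r hr).2 ψ]
  rfl

/-- The densities depend continuously on time, in `L¹` against Schwartz weights. -/
lemma IsCauchySolution.tendsto_lintegral_mul_sub {b c : ℝ → ℝ} {T s : ℝ} {U₀ : 𝓢'(ℝ, ℂ)}
    {U : ℝ → 𝓢'(ℝ, ℂ)} (hU : IsCauchySolution b c T s U₀ U) {v : ℝ → ℝ → ℂ}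
    (hv : ∀ t ∈ Icc 0 T, HasDensity s (𝓕 (U t)) (v t)) {t : ℝ} (ht : t ∈ Icc 0 T)
    (ψ : 𝓢(ℝ, ℂ)) :
    Tendsto (fun r => ∫⁻ ξ, ‖ψ ξ * (v r ξ - v t ξ)‖ₑ) (𝓝[Icc 0 T] t) (𝓝 0) := by
  set W := weightedSq (-s) ψ with hW
  have hWt : W ^ (1 / 2 : ℝ) ≠ ⊤ :=
    ENNReal.rpow_ne_top_of_nonneg (by norm_num) (MemWeighted.weightedSq_schwartz_lt_top _ ψ).ne
  have h0 := ENNReal.Tendsto.const_mul (hU.continuous t ht) (Or.inr hWt)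
  rw [mul_zero] at h0
  refine tendsto_of_tendsto_of_tendsto_of_le_of_le' tendsto_const_nhds h0
    (Eventually.of_forall fun _ => zero_le) ?_
  filter_upwards [self_mem_nhdsWithin] with r hr
  have hd := (hv r hr).sub (hv t ht)
  have e : 𝓕 (U r) - 𝓕 (U t) = 𝓕 (U r - U t) :=
    (map_sub (FourierTransform.fourierCLM ℂ 𝓢'(ℝ, ℂ)) _ _).symm
  rw [e] at hd
  rw [sobolevENorm_eq_of_hasDensity hd]
  have h1 := hd.1.lintegral_schwartz_mul_le ψ
  have h2 := ENNReal.rpow_le_rpow h1 (z := 1 / 2) (by norm_num)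
  rw [← ENNReal.rpow_natCast, ← ENNReal.rpow_mul, ENNReal.mul_rpow_of_nonneg _ _ (by norm_num),
    show ((2 : ℕ) : ℝ) * (1 / 2) = 1 by norm_num, ENNReal.rpow_one] at h2
  refine h2.trans ?_
  gcongr
  refine le_mul_of_one_le_left zero_le ?_
  rw [ENNReal.one_le_ofReal, Real.one_le_sqrt]
  linarith [Real.pi_gt_three]

/-- A product rule: the pairing of a time-dependent test function, Lipschitz and differentiable in
time, with a time-dependent density that is continuous and weakly differentiable. -/
lemma continuousOn_and_hasDerivAt_integral_mul {T s M : ℝ} {v : ℝ → ℝ → ℂ}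
    {χ : ℝ → 𝓢(ℝ, ℂ)} {χ' : ℝ → ℝ → ℂ} {G : 𝓢(ℝ, ℂ)} {D : ℝ → ℂ}
    (hv : ∀ t ∈ Icc 0 T, MemWeighted s (v t))
    (hcont : ∀ t ∈ Icc 0 T, ∀ ψ : 𝓢(ℝ, ℂ),
      Tendsto (fun r => ∫⁻ ξ, ‖ψ ξ * (v r ξ - v t ξ)‖ₑ) (𝓝[Icc 0 T] t) (𝓝 0))
    (hlip : ∀ r ∈ Icc 0 T, ∀ t ∈ Icc 0 T, ∀ ξ, ‖χ r ξ - χ t ξ‖ ≤ M * |r - t| * ‖G ξ‖)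
    (hM : 0 ≤ M)
    (hχ : ∀ t ∈ Ioo 0 T, ∀ ξ, HasDerivAt (fun r => χ r ξ) (χ' t ξ) t)
    (hD : ∀ t ∈ Ioo 0 T, HasDerivAt (fun r => ∫ ξ, χ t ξ * v r ξ) (D t) t) :
    ContinuousOn (fun t => ∫ ξ, χ t ξ * v t ξ) (Icc 0 T) ∧
    ∀ t ∈ Ioo 0 T, HasDerivAt (fun r => ∫ ξ, χ r ξ * v r ξ) (D t + ∫ ξ, χ' t ξ * v t ξ) t := by
  -- the increment of the pairing, as first order terms plus a remainder of second order
  have key : ∀ t ∈ Icc 0 T, ∀ r ∈ Icc 0 T, ∫ ξ, χ r ξ * v r ξ = (∫ ξ, χ t ξ * v r ξ) +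
      ((∫ ξ, χ r ξ * v t ξ) - ∫ ξ, χ t ξ * v t ξ) +
        ∫ ξ, (χ r ξ - χ t ξ) * (v r ξ - v t ξ) := by
    intro t ht r hr
    have i1 := (hv t ht).integrable_schwartz_mul (χ t)
    have i2 := (hv t ht).integrable_schwartz_mul (χ r)
    have i3 := (hv r hr).integrable_schwartz_mul (χ t)
    have i4 := (hv r hr).integrable_schwartz_mul (χ r)
    have e : ∀ ξ, (χ r ξ - χ t ξ) * (v r ξ - v t ξ) =
        (χ r ξ * v r ξ - χ r ξ * v t ξ) - (χ t ξ * v r ξ - χ t ξ * v t ξ) := fun ξ => by ring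
    simp_rw [e]
    have e1 := integral_sub (i4.sub i2) (i3.sub i1)
    simp only [Pi.sub_apply] at e1
    rw [e1, integral_sub i4 i2, integral_sub i3 i1]
    ring
  set ε : 𝓢(ℝ, ℂ) → ℝ → ℝ → ℝ := fun ψ t r => (∫⁻ ξ, ‖ψ ξ * (v r ξ - v t ξ)‖ₑ).toReal with hε
  have hεt : ∀ ψ, ∀ t ∈ Icc 0 T, Tendsto (ε ψ t) (𝓝[Icc 0 T] t) (𝓝 0) := fun ψ t ht =>
    (ENNReal.tendsto_toReal ENNReal.zero_ne_top).comp (hcont t ht ψ)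
  have hεi : ∀ ψ, ∀ t ∈ Icc 0 T, ∀ r ∈ Icc 0 T, ∫ ξ, ‖ψ ξ * (v r ξ - v t ξ)‖ = ε ψ t r :=
    fun ψ t ht r hr => by
      rw [hε, integral_norm_eq_lintegral_enorm
        (((hv r hr).sub (hv t ht)).integrable_schwartz_mul ψ).1]
  have hrem : ∀ t ∈ Icc 0 T, ∀ r ∈ Icc 0 T,
      ‖∫ ξ, (χ r ξ - χ t ξ) * (v r ξ - v t ξ)‖ ≤ M * (|r - t| * ε G t r) := by
    intro t ht r hr
    rw [← hεi G t ht r hr, ← mul_assoc, ← integral_const_mul]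
    refine norm_integral_le_of_norm_le
      (((((hv r hr).sub (hv t ht)).integrable_schwartz_mul G).norm).const_mul _)
      (ae_of_all _ fun ξ => ?_)
    rw [norm_mul, norm_mul, ← mul_assoc]
    gcongr
    exact hlip r hr t ht ξ
  have hmid : ∀ t ∈ Icc 0 T, ∀ r ∈ Icc 0 T,
      ‖(∫ ξ, χ r ξ * v t ξ) - ∫ ξ, χ t ξ * v t ξ‖ ≤ M * |r - t| * ∫ ξ, ‖G ξ * v t ξ‖ := by
    intro t ht r hr
    rw [← integral_sub ((hv t ht).integrable_schwartz_mul _)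
      ((hv t ht).integrable_schwartz_mul _), ← integral_const_mul]
    refine norm_integral_le_of_norm_le
      (((hv t ht).integrable_schwartz_mul G).norm.const_mul _) (ae_of_all _ fun ξ => ?_)
    rw [← sub_mul, norm_mul, norm_mul, ← mul_assoc]
    gcongr
    exact hlip r hr t ht ξ
  have habs : ∀ t : ℝ, Tendsto (fun r => |r - t|) (𝓝[Icc 0 T] t) (𝓝 0) := fun t => by
    have : Continuous fun r : ℝ => |r - t| := by fun_prop
    simpa using (this.tendsto t).mono_left nhdsWithin_le_nhds
  refine ⟨fun t ht => ?_, fun t ht => ?_⟩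
  · have h1 : Tendsto (fun r => ∫ ξ, χ t ξ * v r ξ) (𝓝[Icc 0 T] t) (𝓝 (∫ ξ, χ t ξ * v t ξ)) := by
      rw [tendsto_iff_norm_sub_tendsto_zero]
      refine squeeze_zero' (Eventually.of_forall fun _ => norm_nonneg _) ?_ (hεt (χ t) t ht)
      filter_upwards [self_mem_nhdsWithin] with r hr
      rw [← hεi (χ t) t ht r hr, ← integral_sub ((hv r hr).integrable_schwartz_mul _)
        ((hv t ht).integrable_schwartz_mul _)]
      simp_rw [← mul_sub]
      exact norm_integral_le_integral_norm _
    have h2 : Tendsto (fun r => (∫ ξ, χ r ξ * v t ξ) - ∫ ξ, χ t ξ * v t ξ) (𝓝[Icc 0 T] t)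
        (𝓝 0) := by
      rw [tendsto_zero_iff_norm_tendsto_zero]
      refine squeeze_zero' (Eventually.of_forall fun _ => norm_nonneg _) ?_
        (g := fun r => M * |r - t| * ∫ ξ, ‖G ξ * v t ξ‖) ?_
      · filter_upwards [self_mem_nhdsWithin] with r hr using hmid t ht r hr
      · simpa using ((habs t).const_mul M).mul_const (∫ ξ, ‖G ξ * v t ξ‖)
    have h3 : Tendsto (fun r => ∫ ξ, (χ r ξ - χ t ξ) * (v r ξ - v t ξ)) (𝓝[Icc 0 T] t)
        (𝓝 0) := by
      rw [tendsto_zero_iff_norm_tendsto_zero]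
      refine squeeze_zero' (Eventually.of_forall fun _ => norm_nonneg _) ?_
        (g := fun r => M * (|r - t| * ε G t r)) ?_
      · filter_upwards [self_mem_nhdsWithin] with r hr using hrem t ht r hr
      · simpa using ((habs t).mul (hεt G t ht)).const_mul M
    have h := (h1.add h2).add h3
    rw [add_zero, add_zero] at h
    refine h.congr' ?_
    filter_upwards [self_mem_nhdsWithin] with r hr using (key t ht r hr).symm
  · have htI := Ioo_subset_Icc_self ht
    have hnhds : 𝓝[Icc 0 T] t = 𝓝 t := nhdsWithin_eq_nhds.2 (Icc_mem_nhds ht.1 ht.2)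
    have hG := (hv t htI).integrable_schwartz_mul G
    have h2 : HasDerivAt (fun r => (∫ ξ, χ r ξ * v t ξ) - ∫ ξ, χ t ξ * v t ξ)
        (∫ ξ, χ' t ξ * v t ξ) t := by
      refine HasDerivAt.sub_const _ ?_
      have hs : Icc 0 T ∈ 𝓝 t := Icc_mem_nhds ht.1 ht.2
      refine (hasDerivAt_integral_of_dominated_loc_of_lip (F := fun r ξ => χ r ξ * v t ξ)
        (bound := fun ξ => M * ‖G ξ * v t ξ‖) hs
        (Eventually.of_forall fun r => ((hv t htI).integrable_schwartz_mul _).1)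
        ((hv t htI).integrable_schwartz_mul _) ?_ (ae_of_all _ fun ξ => ?_)
        (hG.norm.const_mul M) (ae_of_all _ fun ξ => (hχ t ht ξ).mul_const _)).2
      · refine AEStronglyMeasurable.mul ?_ (hv t htI).1
        -- a limit of difference quotients is measurable
        have hseq : ∀ ξ, Tendsto (fun k : ℕ => ((1 / ((k : ℝ) + 1) : ℝ) : ℝ)⁻¹ •
            (χ (t + 1 / ((k : ℝ) + 1)) ξ - χ t ξ)) atTop (𝓝 (χ' t ξ)) := by
          intro ξ
          have h := hasDerivAt_iff_tendsto_slope_zero.1 (hχ t ht ξ)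
          refine h.comp (tendsto_nhdsWithin_iff.2
            ⟨tendsto_one_div_add_atTop_nhds_zero_nat, Eventually.of_forall fun k => ?_⟩)
          have : (0 : ℝ) < 1 / ((k : ℝ) + 1) := by positivity
          exact this.ne'
        refine aestronglyMeasurable_of_tendsto_ae atTop (f := fun (k : ℕ) ξ =>
            ((1 / ((k : ℝ) + 1) : ℝ) : ℝ)⁻¹ • (χ (t + 1 / ((k : ℝ) + 1)) ξ - χ t ξ))
          (fun k => Continuous.aestronglyMeasurable ?_)
          (ae_of_all _ hseq)
        have h1 := (χ (t + 1 / ((k : ℝ) + 1))).continuous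
        have h2 := (χ t).continuous
        fun_prop
      · refine LipschitzOnWith.of_dist_le_mul fun r hr q hq => ?_
        rw [dist_eq_norm, dist_eq_norm, ← sub_mul, norm_mul, Real.coe_nnabs,
          abs_of_nonneg (by positivity), norm_mul, Real.norm_eq_abs]
        calc _ ≤ M * |r - q| * ‖G ξ‖ * ‖v t ξ‖ := by gcongr; exact hlip r hr q hq ξ
          _ = _ := by ring
    have h3 : HasDerivAt (fun r => ∫ ξ, (χ r ξ - χ t ξ) * (v r ξ - v t ξ)) 0 t := by
      rw [hasDerivAt_iff_isLittleO]
      have hb : (fun r => ∫ ξ, (χ r ξ - χ t ξ) * (v r ξ - v t ξ)) =O[𝓝 t]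
          fun r => (r - t) * ε G t r := by
        refine Asymptotics.IsBigO.of_bound M ?_
        filter_upwards [Icc_mem_nhds ht.1 ht.2] with r hr
        refine (hrem t htI r hr).trans (le_of_eq ?_)
        rw [norm_mul, Real.norm_eq_abs, Real.norm_of_nonneg ENNReal.toReal_nonneg]
      have hl : (fun r => (r - t) * ε G t r) =o[𝓝 t] fun r => (r - t) * (1 : ℝ) :=
        (Asymptotics.isBigO_refl _ _).mul_isLittleO
          ((Asymptotics.isLittleO_one_iff ℝ).2 (hnhds ▸ hεt G t htI))
      simpa using hb.trans_isLittleO hl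
    have h := ((hD t ht).add h2).add h3
    rw [add_zero] at h
    refine h.congr_of_eventuallyEq ?_
    filter_upwards [Icc_mem_nhds ht.1 ht.2] with r hr using key t htI r hr

lemma contDiff_phase {n : WithTop ℕ∞} (B C : ℝ → ℝ) (t : ℝ) :
    ContDiff ℝ n fun ξ => phase B C ξ t := by
  have h : ∀ f : ℝ → ℝ, ContDiff ℝ n f → ContDiff ℝ n fun ξ => (f ξ : ℂ) := fun f hf =>
    Complex.ofRealCLM.contDiff.comp hf
  have h1 := h (fun ξ => (2 * Real.pi * ξ) ^ 2) (by fun_prop)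
  have h2 := h (fun ξ => 2 * Real.pi * ξ) (by fun_prop)
  unfold phase
  fun_prop

/-- A smooth compactly supported function, damped by the exponential of minus the phase. -/
def dampedTest (B C : ℝ → ℝ) {g : ℝ → ℝ} (hg : ContDiff ℝ ((⊤ : ℕ∞) : WithTop ℕ∞) g)
    (hgs : HasCompactSupport g) (t : ℝ) : 𝓢(ℝ, ℂ) :=
  HasCompactSupport.toSchwartzMap
    (f := fun ξ => Complex.exp (-phase B C ξ t) * ((g ξ : ℝ) : ℂ))
    ((hgs.comp_left (g := fun y : ℝ => (y : ℂ)) Complex.ofReal_zero).mul_left)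
    (ContDiff.mul (contDiff_phase B C t).neg.cexp (Complex.ofRealCLM.contDiff.comp hg))

lemma dampedTest_apply (B C : ℝ → ℝ) {g : ℝ → ℝ} (hg : ContDiff ℝ ((⊤ : ℕ∞) : WithTop ℕ∞) g)
    (hgs : HasCompactSupport g) (t ξ : ℝ) :
    dampedTest B C hg hgs t ξ = Complex.exp (-phase B C ξ t) * ((g ξ : ℝ) : ℂ) := rfl

section solutionFormula

variable {T : ℝ} {b c B C : ℝ → ℝ}

lemma IsPrimitive.hasDerivWithinAt_exp_neg_phase (hB : IsPrimitive T b B)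
    (hC : IsPrimitive T c C) {t : ℝ} (ht : t ∈ Icc 0 T) (ξ : ℝ) :
    HasDerivWithinAt (fun r => Complex.exp (-phase B C ξ r))
      (-(symbol (b t) (c t) ξ * Complex.exp (-phase B C ξ t))) (Icc 0 T) t := by
  have h := (hasDerivWithinAt_phase (hB.hasDerivWithinAt t ht) (hC.hasDerivWithinAt t ht) ξ).neg.cexp
  refine h.congr_deriv ?_
  rw [symbol]
  simp only [Pi.neg_apply]
  ring

/-- On compact frequency sets the damping factor is Lipschitz in time. -/
lemma IsPrimitive.exists_lipschitz (hB : IsPrimitive T b B) (hC : IsPrimitive T c C)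
    (hb : ContinuousOn b (Icc 0 T)) (hc : ContinuousOn c (Icc 0 T)) {S : Set ℝ}
    (hS : IsCompact S) :
    ∃ M, 0 ≤ M ∧ ∀ ξ ∈ S, ∀ r ∈ Icc 0 T, ∀ t ∈ Icc 0 T,
      ‖Complex.exp (-phase B C ξ r) - Complex.exp (-phase B C ξ t)‖ ≤ M * |r - t| := by
  have hBc := hB.continuousOn
  have hCc := hC.continuousOn
  have hmt : MapsTo (fun z : ℝ × ℝ => z.2) (S ×ˢ Icc 0 T) (Icc 0 T) := fun z hz => hz.2
  have hcont : ContinuousOn (fun z : ℝ × ℝ => symbol (b z.2) (c z.2) z.1 *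
      Complex.exp (-phase B C z.1 z.2)) (S ×ˢ Icc 0 T) := by
    have h1 := hb.comp continuousOn_snd hmt
    have h2 := hc.comp continuousOn_snd hmt
    have h3 := hBc.comp continuousOn_snd hmt
    have h4 := hCc.comp continuousOn_snd hmt
    simp only [Function.comp_def] at h1 h2 h3 h4
    unfold symbol phase
    fun_prop
  obtain ⟨M, hM⟩ := (hS.prod isCompact_Icc).exists_bound_of_continuousOn hcont
  refine ⟨max M 0, le_max_right _ _, fun ξ hξ r hr t ht => ?_⟩
  refine (convex_Icc 0 T).norm_image_sub_le_of_norm_hasDerivWithin_le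
    (fun q hq => hB.hasDerivWithinAt_exp_neg_phase hC hq ξ) (fun q hq => ?_) ht hr
  rw [norm_neg]
  exact (hM (ξ, q) ⟨hξ, hq⟩).trans (le_max_left _ _)

/-- The solution formula: on the Fourier side the weak solution is the initial datum times the
exponential of the phase. Against the damped test functions the weak solution is constant in
time. -/
theorem IsCauchySolution.hasDensity {s : ℝ} {U₀ : 𝓢'(ℝ, ℂ)} {U : ℝ → 𝓢'(ℝ, ℂ)} (hT : 0 < T)
    (hU : IsCauchySolution b c T s U₀ U) (hb : ContinuousOn b (Icc 0 T))
    (hc : ContinuousOn c (Icc 0 T)) (hB : IsPrimitive T b B) (hC : IsPrimitive T c C)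
    {v₀ : ℝ → ℂ} (hv₀ : HasDensity s (𝓕 U₀) v₀) {t : ℝ} (ht : t ∈ Ioo 0 T) (ψ : 𝓢(ℝ, ℂ)) :
    𝓕 (U t) ψ = ∫ ξ, ψ ξ * (Complex.exp (phase B C ξ t) * v₀ ξ) := by
  have hex : ∀ r, ∃ v, r ∈ Icc 0 T → HasDensity s (𝓕 (U r)) v := fun r => by
    by_cases hr : r ∈ Icc 0 T
    · obtain ⟨v, hv⟩ := exists_hasDensity_of_memSobolev (hU.memSobolev r hr)
      exact ⟨v, fun _ => hv⟩
    · exact ⟨0, fun h => absurd h hr⟩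
  choose v hv using hex
  have h0 : (0 : ℝ) ∈ Icc 0 T := ⟨le_rfl, hT.le⟩
  have htI := Ioo_subset_Icc_self ht
  have hphase : Continuous fun ξ => Complex.exp (-phase B C ξ t) := by unfold phase; fun_prop
  -- the pairing with damped test functions has the same value at the times `t` and `0`
  have key : ∀ g : ℝ → ℝ, ContDiff ℝ ((⊤ : ℕ∞) : WithTop ℕ∞) g → HasCompactSupport g →
      ∫ ξ, g ξ • (Complex.exp (-phase B C ξ t) * v t ξ) = ∫ ξ, g ξ • v₀ ξ := by
    intro g hg hgs
    set χ := dampedTest B C hg hgs with hχ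
    set G := HasCompactSupport.toSchwartzMap (f := fun ξ => ((g ξ : ℝ) : ℂ))
      (hgs.comp_left (g := fun y : ℝ => (y : ℂ)) Complex.ofReal_zero)
      (Complex.ofRealCLM.contDiff.comp hg) with hG
    have hGa : ∀ ξ, G ξ = ((g ξ : ℝ) : ℂ) := fun ξ => rfl
    obtain ⟨M, hM, hlip⟩ := hB.exists_lipschitz hC hb hc hgs.isCompact
    have h := continuousOn_and_hasDerivAt_integral_mul (χ := χ) (G := G) (M := M)
      (χ' := fun r ξ => -(symbol (b r) (c r) ξ * χ r ξ))
      (D := fun r => ∫ ξ, symbol (b r) (c r) ξ * χ r ξ * v r ξ) (v := v) (T := T)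
      (fun r hr => (hv r hr).1) (fun r hr ψ => hU.tendsto_lintegral_mul_sub hv hr ψ) ?_ hM ?_
      (fun r hr => hU.hasDerivAt_integral hv hr (χ r))
    · have hzero : ∀ r ∈ Ioo 0 t, HasDerivAt (fun r => ∫ ξ, χ r ξ * v r ξ) 0 r := fun r hr => by
        refine (h.2 r ⟨hr.1, hr.2.trans ht.2⟩).congr_deriv ?_
        simp_rw [neg_mul]
        rw [integral_neg, add_neg_cancel]
      have hconst := intervalIntegral.integral_eq_sub_of_hasDerivAt_of_le ht.1.le
        (h.1.mono (Icc_subset_Icc_right ht.2.le)) hzero (by simp)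
      rw [intervalIntegral.integral_zero, eq_comm, sub_eq_zero] at hconst
      have hB0 : ∀ ξ, phase B C ξ 0 = 0 := fun ξ => by simp [phase, hB.zero, hC.zero]
      have hG0 : ∀ ξ, χ 0 ξ = G ξ := fun ξ => by
        rw [hχ, dampedTest_apply, hB0, neg_zero, Complex.exp_zero, one_mul, hGa]
      simp_rw [hG0] at hconst
      rw [← (hv 0 h0).2, hU.initial, hv₀.2] at hconst
      calc _ = ∫ ξ, χ t ξ * v t ξ := by
            congr 1; ext ξ
            rw [hχ, dampedTest_apply, Complex.real_smul]
            ring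
        _ = _ := by
            rw [hconst]
            rfl
    · intro r hr q hq ξ
      by_cases hξ : ξ ∈ tsupport g
      · rw [hχ, dampedTest_apply, dampedTest_apply, ← sub_mul, norm_mul, hGa]
        gcongr
        exact hlip ξ hξ r hr q hq
      · have : g ξ = 0 := image_eq_zero_of_notMem_tsupport hξ
        simp [hχ, dampedTest_apply, hGa, this]
    · intro r hr ξ
      have := ((hB.hasDerivWithinAt_exp_neg_phase hC (Ioo_subset_Icc_self hr) ξ).hasDerivAt
        (Icc_mem_nhds hr.1 hr.2)).mul_const ((g ξ : ℝ) : ℂ)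
      refine this.congr_deriv ?_
      rw [hχ, dampedTest_apply]
      ring
  have hae := ae_eq_of_integral_contDiff_smul_eq
    ((hv t htI).1.locallyIntegrable_continuous_mul hphase)
    (by simpa using hv₀.1.locallyIntegrable_continuous_mul (f := fun _ => 1) continuous_const) key
  rw [(hv t htI).2]
  apply integral_congr_ae
  filter_upwards [hae] with ξ hξ
  rw [← hξ, ← mul_assoc (Complex.exp _), ← Complex.exp_add, add_neg_cancel, Complex.exp_zero, one_mul]

end solutionFormula

/-! ### Point values of the solution -/

/-- At positive times the decay of the kernel makes the density integrable, which gives the solution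
point values. -/
lemma LaplaceKernel.integrable_mul {a A : ℝ} {m : ℝ → ℝ → ℂ} (hm : LaplaceKernel a A 0 m)
    (ha : 0 < a) {g : ℝ → ℂ} (hg : AEStronglyMeasurable g) (hgw : weightedSq (-(1 / 2)) g < ⊤)
    {t : ℝ} (ht : t ≠ 0) : Integrable fun ξ => g ξ * m ξ t := by
  have hmt : Measurable fun ξ => m ξ t := hm.measurable.comp measurable_prodMk_right
  have hat : 0 < a * |t| := mul_pos ha (abs_pos.2 ht)
  refine ⟨hg.mul hmt.aestronglyMeasurable, ?_⟩
  have hle : ∀ ξ, ‖g ξ * m ξ t‖ₑ ≤ ENNReal.ofReal (A * (a * |t|)⁻¹) *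
      ((‖g ξ‖ₑ * ENNReal.ofReal (kap ξ ^ (-(1 / 4) : ℝ))) *
        ENNReal.ofReal (kap ξ ^ (-(3 / 4) : ℝ))) := by
    intro ξ
    have hk := kap_pos ξ
    refine (hm.enorm_mul_le g ξ t).trans (le_of_le_of_eq
      (b := ENNReal.ofReal A * (‖g ξ‖ₑ * ENNReal.ofReal ((a * |t|)⁻¹ * kap ξ ^ (-1 : ℝ)))) ?_ ?_)
    · gcongr ENNReal.ofReal A * (‖g ξ‖ₑ * ENNReal.ofReal ?_)
      -- the elementary bound `exp (-y) ≤ 1 / y` at `y = a κ |t|`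
      rw [Real.rpow_zero, one_mul, Real.rpow_neg_one, ← mul_inv, Real.exp_neg]
      refine inv_anti₀ (by positivity) ?_
      have := Real.add_one_le_exp (a * kap ξ * |t|)
      linarith
    · rw [mul_assoc ‖g ξ‖ₑ, ← ENNReal.ofReal_mul (by positivity), ← Real.rpow_add hk,
        ENNReal.ofReal_mul hm.nonneg, ENNReal.ofReal_mul (by positivity)]
      norm_num
      ring
  have hsq := sq_lintegral_mul_le (μ := (volume : Measure ℝ))
    (f := fun ξ => ‖g ξ‖ₑ * ENNReal.ofReal (kap ξ ^ (-(1 / 4) : ℝ)))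
    (g := fun ξ => ENNReal.ofReal (kap ξ ^ (-(3 / 4) : ℝ)))
    (hg.enorm.mul (by fun_prop)) (by fun_prop)
  have e : ∀ (r : ℝ) ξ, ENNReal.ofReal (kap ξ ^ r) ^ 2 = ENNReal.ofReal (kap ξ ^ (2 * r)) := by
    intro r ξ
    rw [← ENNReal.ofReal_pow (Real.rpow_nonneg (kap_pos ξ).le _), ← Real.rpow_natCast,
      ← Real.rpow_mul (kap_pos ξ).le, mul_comm r]
    norm_num
  simp_rw [mul_pow, e] at hsq
  norm_num at hsq
  have hfin := hsq.trans_lt (ENNReal.mul_lt_top (by simpa [weightedSq] using hgw)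
    (by simpa using lintegral_kap_rpow_lt_top))
  have hfin' := (ENNReal.pow_lt_top_iff.1 hfin).resolve_right two_ne_zero
  refine (lintegral_mono hle).trans_lt ?_
  rw [lintegral_const_mul' _ _ ENNReal.ofReal_ne_top]
  norm_num
  exact ENNReal.mul_lt_top ENNReal.ofReal_lt_top hfin'

/-- The Fourier transform of the translate by `x`: multiplication by `exp (2πiξx)`. -/
def modulate (x : ℝ) (v : ℝ → ℂ) (ξ : ℝ) : ℂ := Real.fourierChar (ξ * x) • v ξ

lemma weightedSq_modulate (q x : ℝ) (v : ℝ → ℂ) : weightedSq q (modulate x v) = weightedSq q v := by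
  unfold weightedSq modulate
  simp_rw [← ofReal_norm, Circle.norm_smul]

lemma aestronglyMeasurable_modulate (x : ℝ) {v : ℝ → ℂ} (hv : AEStronglyMeasurable v) :
    AEStronglyMeasurable (modulate x v) := by
  have : Continuous fun ξ : ℝ => Real.fourierChar (ξ * x) :=
    Real.continuous_fourierChar.comp (by fun_prop)
  exact this.aestronglyMeasurable.smul hv

lemma superpose_modulate (x : ℝ) (v : ℝ → ℂ) (m : ℝ → ℝ → ℂ) (t : ℝ) :
    superpose (modulate x v) m t = 𝓕 (fun ξ => v ξ * m ξ t) (-x) := by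
  rw [Real.fourier_real_eq]
  unfold superpose modulate
  congr 1; ext ξ
  rw [mul_neg, neg_neg, smul_mul_assoc]

/-- A tempered distribution whose Fourier transform is integrable is a continuous function. -/
lemma eq_integral_of_fourier_eq {V : 𝓢'(ℝ, ℂ)} {w : ℝ → ℂ} (hw : Integrable w)
    (hV : ∀ ψ : 𝓢(ℝ, ℂ), 𝓕 V ψ = ∫ ξ, ψ ξ * w ξ) :
    Continuous (fun x => 𝓕 w (-x)) ∧ ∀ φ : 𝓢(ℝ, ℂ),
      Integrable (fun x => φ x * 𝓕 w (-x)) ∧ V φ = ∫ x, φ x * 𝓕 w (-x) := by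
  have hc : Continuous (fun x => 𝓕 w (-x)) := (continuous_fourier_of_integrable hw).comp continuous_neg
  refine ⟨hc, fun φ => ⟨?_, ?_⟩⟩
  · exact φ.integrable.mul_bdd hc.aestronglyMeasurable
      (ae_of_all _ fun x => norm_fourier_le_integral_norm w (-x))
  · have h1 : V φ = 𝓕 V (𝓕⁻ φ) := by
      change V φ = V (𝓕 (𝓕⁻ φ))
      rw [FourierTransform.fourier_fourierInv_eq]
    have h2 := VectorFourier.integral_fourierIntegral_smul_eq_flip (μ := volume) (ν := volume)
      (L := innerₗ ℝ) (f := fun x => φ (-x)) (g := w) Real.continuous_fourierChar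
      continuous_inner φ.integrable.comp_neg hw
    rw [flip_innerₗ] at h2
    rw [h1, hV]
    calc ∫ ξ, (𝓕⁻ φ) ξ * w ξ = ∫ ξ, 𝓕 (fun x => φ (-x)) ξ • w ξ := by
          rw [SchwartzMap.fourierInv_coe, Real.fourierInv_eq_fourier_comp_neg]
          rfl
      _ = ∫ x, φ (-x) • 𝓕 w x := h2
      _ = ∫ x, φ x * 𝓕 w (-x) := by
          rw [← integral_neg_eq_self]
          simp only [neg_neg, smul_eq_mul]

/-! ### Sobolev norms of traces -/

/-- The Sobolev norm of a function in `L¹ ∩ L²`, in terms of its Fourier integral. -/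
lemma sobolevENorm_toLp {f : ℝ → ℂ} (hf : Integrable f) (hf2 : MemLp f 2) {σ : ℝ}
    (hσ : weightedSq σ (𝓕 f) < ⊤) :
    sobolevENorm σ (hf2.toLp f : 𝓢'(ℝ, ℂ)) =
      ENNReal.ofReal (√(2 * Real.pi)) * weightedSq σ (𝓕 f) ^ (1 / 2 : ℝ) := by
  refine sobolevENorm_eq_of_hasDensity ⟨⟨?_, hσ⟩, fun ψ => ?_⟩
  · exact (continuous_fourier_of_integrable hf).aestronglyMeasurable
  · rw [Lp.fourier_toTemperedDistribution_eq, Lp.toTemperedDistribution_apply]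
    apply integral_congr_ae
    filter_upwards [fourier_toLp_ae_eq hf hf2] with τ hτ
    rw [hτ, smul_eq_mul]

lemma RestrictsTo.sobolevENormOn_le {Ω : TopologicalSpace.Opens ℝ} {F : 𝓢'(ℝ, ℂ)} {u : 𝓓'(Ω, ℂ)}
    (h : RestrictsTo F u) (σ : ℝ) : sobolevENormOn σ u ≤ sobolevENorm σ F := iInf₂_le F h

lemma restrictsTo_toLp {Ω : TopologicalSpace.Opens ℝ} {f : ℝ → ℂ} (hf2 : MemLp f 2)
    (hf : LocallyIntegrableOn f Ω) :
    RestrictsTo (hf2.toLp f : 𝓢'(ℝ, ℂ)) (funDistribution Ω f) := by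
  intro φ
  have e : funDistribution Ω f φ = ∫ x, ContinuousLinearMap.lsmul ℝ ℝ (φ x) (f x) :=
    TestFunction.integralAgainstBilinCLM_eq_integral hf
  rw [e, Lp.toTemperedDistribution_apply]
  apply integral_congr_ae
  filter_upwards [hf2.coeFn_toLp] with t ht
  rw [ht]
  rfl

lemma abs_iteratedDerivWithin_le_contDiffNorm {m j : ℕ} (hj : j ≤ m) {T : ℝ} (hT : 0 < T)
    {f : ℝ → ℝ} (hf : ContDiffOn ℝ m f (Icc 0 T)) {t : ℝ} (ht : t ∈ Icc 0 T) :
    |iteratedDerivWithin j f (Icc 0 T) t| ≤ contDiffNorm m T f := by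
  have hc : ContinuousOn (fun t => |iteratedDerivWithin j f (Icc 0 T) t|) (Icc 0 T) :=
    (hf.continuousOn_iteratedDerivWithin (by exact_mod_cast hj) (uniqueDiffOn_Icc hT)).abs
  have hbdd := isCompact_Icc.bddAbove_image hc
  have h1 : |iteratedDerivWithin j f (Icc 0 T) t| ≤
      ⨆ t : Icc (0 : ℝ) T, |iteratedDerivWithin j f (Icc 0 T) t| := by
    refine le_ciSup (f := fun t : Icc (0 : ℝ) T => |iteratedDerivWithin j f (Icc 0 T) t|) ?_ ⟨t, ht⟩
    rw [image_eq_range] at hbdd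
    exact hbdd
  refine h1.trans (Finset.single_le_sum
    (f := fun j => ⨆ t : Icc (0 : ℝ) T, |iteratedDerivWithin j f (Icc 0 T) t|)
    (fun i _ => Real.iSup_nonneg fun _ => abs_nonneg _) (Finset.mem_range.2 (by omega)))

lemma contDiffNorm_nonneg (m : ℕ) (T : ℝ) (f : ℝ → ℝ) : 0 ≤ contDiffNorm m T f :=
  Finset.sum_nonneg fun _ _ => Real.iSup_nonneg fun _ => abs_nonneg _

end HeatTrace

end

theorem mainTheorem5 (n : ℕ) (hn : 1 ≤ n) (s : ℝ) (hs₁ : -(1 / 2) ≤ s)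
    (hs₂ : s ≤ 2 * (n : ℝ) - 1 / 2) (b₀ : ℝ) (hb₀ : 0 < b₀) :
    -- the constant, a function of `T` and of the `C^(n-1)([0,T])` norms of `b` and `c`
    ∃ c₂ : ℝ → ℝ → ℝ → ℝ,
      (∀ T β γ : ℝ, 0 < c₂ T β γ) ∧
      -- it remains bounded as `T → 0+`, uniformly for bounded norms of the coefficients
      (∀ M : ℝ, ∃ K : ℝ, ∀ᶠ T in 𝓝[>] (0 : ℝ),
        ∀ β ∈ Icc 0 M, ∀ γ ∈ Icc 0 M, c₂ T β γ ≤ K) ∧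
      ∀ (L T : ℝ), 0 < L → 0 < T →
      ∀ b c : ℝ → ℝ, ContDiffOn ℝ n b (Icc 0 T) → ContDiffOn ℝ n c (Icc 0 T) →
        (∀ t ∈ Icc 0 T, b₀ ≤ b t) →
      ∀ (u₀ : 𝓓'(HeatTrace.openIoo 0 L, ℂ)) (U₀ : 𝓢'(ℝ, ℂ)),
        MemSobolev s 2 U₀ → HeatTrace.RestrictsTo U₀ u₀ →
        HeatTrace.sobolevENorm s U₀ ≤ 2 * HeatTrace.sobolevENormOn s u₀ →
      ∀ U : ℝ → 𝓢'(ℝ, ℂ), HeatTrace.IsCauchySolution b c T s U₀ U →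
      ∃ u : ℝ → ℝ → ℂ, HeatTrace.IsPointValues T U u ∧
        ∀ x ∈ Icc 0 L,
          LocallyIntegrableOn (u x) (Ioo 0 T) ∧
          HeatTrace.sobolevENormOn ((2 * s + 1) / 4)
              (HeatTrace.funDistribution (HeatTrace.openIoo 0 T) (u x)) ≤
            ENNReal.ofReal (c₂ T (HeatTrace.contDiffNorm (n - 1) T b)
                (HeatTrace.contDiffNorm (n - 1) T c)) *
              HeatTrace.sobolevENormOn s u₀ := by
  
  obtain ⟨C, hC0, hC⟩ := HeatTrace.lintegral_fourier_superpose_le n ((2 * s + 1) / 4) (by linarith)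
    (by linarith)
  obtain ⟨K, hK0, hK⟩ := HeatTrace.exists_kernel n b₀ hb₀
  have hs : 2 * ((2 * s + 1) / 4) - 1 / 2 = s := by ring
  simp only [hs] at hC
  -- twice (from the choice of `U₀`) the square root of the constant `C A² / b₀` of the trace estimate
  refine ⟨fun T β γ => 2 * (√(C / b₀) * (K * (Real.exp (b₀ * T) * (1 + |β| + |γ|) ^ n))),
    fun T β γ => by positivity, fun M => ?_, ?_⟩
  · refine ⟨2 * (√(C / b₀) * (K * (Real.exp (b₀ * 1) * (1 + |M| + |M|) ^ n))), ?_⟩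
    filter_upwards [Ioo_mem_nhdsGT (zero_lt_one' ℝ)] with T hT β hβ γ hγ
    have h1 : |β| ≤ |M| := abs_le_abs_of_nonneg hβ.1 hβ.2
    have h2 : |γ| ≤ |M| := abs_le_abs_of_nonneg hγ.1 hγ.2
    have h3 : T ≤ 1 := hT.2.le
    gcongr
  intro L T hL hT b c hb hc hbb u₀ U₀ hU₀ hres hU₀le U hU
  set β := HeatTrace.contDiffNorm (n - 1) T b with hβ
  set γ := HeatTrace.contDiffNorm (n - 1) T c with hγ
  have hβ0 : 0 ≤ β := HeatTrace.contDiffNorm_nonneg _ _ _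
  have hγ0 : 0 ≤ γ := HeatTrace.contDiffNorm_nonneg _ _ _
  have hn1 : ((n - 1 : ℕ) : WithTop ℕ∞) ≤ n := by exact_mod_cast Nat.sub_le n 1
  obtain ⟨B, hB⟩ := HeatTrace.exists_isPrimitive hT.le hb.continuousOn
  obtain ⟨C', hC'⟩ := HeatTrace.exists_isPrimitive hT.le hc.continuousOn
  obtain ⟨m, h, hm, hh, hF, hmt⟩ := hK T β γ b c B C' hT hβ0 hγ0 hb hc hB hC' hbb
    (fun i hi t ht => HeatTrace.abs_iteratedDerivWithin_le_contDiffNorm hi hT (hb.of_le hn1) ht)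
    (fun i hi t ht => HeatTrace.abs_iteratedDerivWithin_le_contDiffNorm hi hT (hc.of_le hn1) ht)
  set A := K * (Real.exp (b₀ * T) * (1 + β + γ) ^ n) with hA
  have hA0 : 0 ≤ A := by positivity
  obtain ⟨v₀, hv₀⟩ := HeatTrace.exists_hasDensity_of_memSobolev hU₀
  have hv0m := hv₀.1.1
  have hv0w : HeatTrace.weightedSq (-(1 / 2)) v₀ < ⊤ :=
    (HeatTrace.weightedSq_mono hs₁ v₀).trans_lt hv₀.1.2
  refine ⟨fun x => HeatTrace.superpose (HeatTrace.modulate x v₀) m, fun t ht => ?_, fun x _ => ?_⟩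
  · have hw := hm.integrable_mul hb₀ hv0m hv0w ht.1.ne'
    simp only [HeatTrace.superpose_modulate]
    refine HeatTrace.eq_integral_of_fourier_eq hw fun ψ => ?_
    rw [hU.hasDensity hT hb.continuousOn hc.continuousOn hB hC' hv₀ ht ψ]
    congr 1; ext ξ
    rw [hmt ξ t ⟨ht.1, ht.2.le⟩, mul_comm (v₀ ξ)]
  · set g := HeatTrace.modulate x v₀ with hg
    have hgm : AEStronglyMeasurable g := HeatTrace.aestronglyMeasurable_modulate x hv0m
    have hgw : ∀ q, HeatTrace.weightedSq q g = HeatTrace.weightedSq q v₀ := fun q =>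
      HeatTrace.weightedSq_modulate q x v₀
    have hg0 : HeatTrace.weightedSq (2 * 0 - 1 / 2) g < ⊤ := by
      rw [hgw]
      simpa using hv0w
    have hi := hm.integrable_superpose hb₀ hgm hg0
    have h2 := hm.memLp_superpose hb₀ hgm hg0
    have hloc : LocallyIntegrableOn (HeatTrace.superpose g m) (Ioo 0 T) :=
      hi.locallyIntegrable.locallyIntegrableOn _
    refine ⟨hloc, ?_⟩
    have hbound := hC b₀ A m h hb₀ hm hh hF g hgm (by rw [hgw]; exact hv₀.1.2)
    rw [hgw] at hbound
    have hfin : HeatTrace.weightedSq ((2 * s + 1) / 4) (𝓕 (HeatTrace.superpose g m)) < ⊤ :=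
      lt_of_le_of_lt hbound (ENNReal.mul_lt_top ENNReal.ofReal_lt_top hv₀.1.2)
    beta_reduce
    rw [abs_of_nonneg hβ0, abs_of_nonneg hγ0]
    calc _ ≤ HeatTrace.sobolevENorm ((2 * s + 1) / 4) (h2.toLp _ : 𝓢'(ℝ, ℂ)) :=
          (HeatTrace.restrictsTo_toLp h2 hloc).sobolevENormOn_le _
      _ = ENNReal.ofReal (√(2 * Real.pi)) * HeatTrace.weightedSq ((2 * s + 1) / 4)
            (𝓕 (HeatTrace.superpose g m)) ^ (1 / 2 : ℝ) := HeatTrace.sobolevENorm_toLp hi h2 hfin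
      _ ≤ ENNReal.ofReal (√(2 * Real.pi)) * (ENNReal.ofReal (C * (A ^ 2 / b₀)) *
            HeatTrace.weightedSq s v₀) ^ (1 / 2 : ℝ) := by
          gcongr
          exact hbound
      _ = ENNReal.ofReal (√(C / b₀) * A) * HeatTrace.sobolevENorm s U₀ := by
          rw [HeatTrace.sobolevENorm_eq_of_hasDensity hv₀, ENNReal.mul_rpow_of_nonneg _ _ (by norm_num),
            ENNReal.ofReal_rpow_of_nonneg (by positivity) (by norm_num), mul_left_comm,
            ← Real.sqrt_eq_rpow, show C * (A ^ 2 / b₀) = C / b₀ * A ^ 2 by ring,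
            Real.sqrt_mul (by positivity), Real.sqrt_sq hA0]
      _ ≤ ENNReal.ofReal (√(C / b₀) * A) * (2 * HeatTrace.sobolevENormOn s u₀) := by gcongr
      _ = _ := by
          rw [← mul_assoc, mul_comm _ (2 : ℝ≥0∞), ENNReal.ofReal_mul (p := 2) (by norm_num),
            ENNReal.ofReal_ofNat]
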